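/- Let $N\ge 2$ be an integer and let $\mathbb T$ be the unit circle with normalized Haar measure $\mu$. For $m_0\in L^\infty(\mathbb T)$ put $$R_{m_0,m_0}f(z)=\frac1N\sum_{w^N=z}|m_0(w)|^2f(w)\qquad(z\in\mathbb T).$$ Assume that $m_0$ is non-singular, i.e. $m_0\neq0$ a.e. and $|m_0|$ is not a.e. equal to $1$. Let $h\in L^1(\mathbb T)$ with $h\ge0$ and $R_{m_0,m_0}h=h$. Let $(U_h,\pi_h,H_h,\varphi_h)$ be the cyclic representation associated to $h$, i.e. (up to unitary equivalence) a Hilbert space $H_h$, a unitary $U_h$ on $H_h$, a unital $*$-representation $\pi_h$ of $L^\infty(\mathbb T)$ on $H_h$ and a vector $\varphi_h\in H_h$ such that the vectors $U_h^{-n}\pi_h(f)\varphi_h$ ($n\in\mathbb N$, $f\in L^\infty(\mathbb T)$) span a dense subspace of $H_h$, and, for all $f\in L^\infty(\mathbb T)$, $$U_h\pi_h(f)U_h^{-1}=\pi_h(f(z^N)),\qquad U_h\varphi_h=\pi_h(m_0)\varphi_h,\qquad \langle\pi_h(f)\varphi_h,\varphi_h\rangle=\int_{\mathbb T}fh\,d\mu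 .$$ Put $T_h=\pi_h(z)$, $V_0^h=\overline{\mathrm{span}}\{T_h^k\varphi_h : k\in\mathbb Z\}$ and $V_j^h=U_h^{-j}V_0^h$ for $j\in\mathbb Z$. Then: 1. $U_hT_hU_h^{-1}=T_h^N$; 2. $V_j^h\subset V_{j+1}^h$ for all $j\in\mathbb Z$; 3. $\overline{\bigcup_{j\in\mathbb Z}V_j^h}=H_h$; 4. $\bigcap_{j\in\mathbb Z}V_j^h=\{0\}$, provided that $R_{m_0,m_0}1=1$ a.e. (in particular if $h=1$), or, more generally, that it is not the case that both $h(z)>0$ and $|m_0(z)|^2h(z)=h(z^N)$ hold for a.e. $z$. Assume now $h=1$. Then: 5. $\{T_h^k\varphi_h : k\in\mathbb Z\}$ is an orthonormal basis of $V_0^h$; 6. if $m_1,\dots,m_{N-1}\in L^\infty(\mathbb T)$ are such that, with $\rho=e^{2\pi i/N}$, the $N\times N$ matrix $\frac1{\sqrt N}\bigl(m_i(\rho^jz)\bigr)_{0\le i,j\le N-1}$ is unitary for a.e. $z\in\mathbb T$, and $\psi_i^h=U_h^{-1}\pi_h(m_i)\varphi_h$ for $i=1,\dots,N-1$, then $\{T_h^k\psi_i^h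 : k\in\mathbb Z,\ 1\le i\le N-1\}$ is an orthonormal basis of $V_1^h\ominus V_0^h$, and $\{U_h^mT_h^n\psi_i^h : m,n\in\mathbb Z,\ 1\le i\le N-1\}$ is an orthonormal basis of $H_h$. -/

import Mathlib

open MeasureTheory
open scoped ENNReal

noncomputable section

namespace CyclicWavelet

/-! ### The circle with its normalized Haar measure -/

instance instMeasurableSpaceCircle : MeasurableSpace Circle := borel Circle

instance instBorelSpaceCircle : BorelSpace Circle := ⟨rfl⟩

/-- The normalized Haar measure on the unit circle `𝕋`. -/
def μT : Measure Circle := Measure.haarMeasure ⊤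

instance instIsHaarMeasure : Measure.IsHaarMeasure μT := by
  unfold μT; infer_instance

instance instIsProbabilityMeasure : IsProbabilityMeasure μT := ⟨by
  simpa [μT] using Measure.haarMeasure_self (K₀ := (⊤ : TopologicalSpace.PositiveCompacts Circle))⟩

/-- The map `z ↦ z ^ N` preserves the normalized Haar measure of the circle. -/
theorem measurePreserving_pow (N : ℕ) [NeZero N] :
    MeasurePreserving (fun z : Circle => z ^ N) μT μT := by
  have hs : Function.Surjective (powMonoidHom N : Circle →* Circle) := by
    intro z
    refine ⟨Circle.exp ((z : ℂ).arg / N), ?_⟩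
    have hN : (N : ℝ) ≠ 0 := Nat.cast_ne_zero.mpr (NeZero.ne N)
    have h1 : ∀ (n : ℕ) (t : ℝ), Circle.exp t ^ n = Circle.exp (n * t) := by
      intro n t
      induction n with
      | zero => simp
      | succ k ih => rw [pow_succ, ih, ← Circle.exp_add]; congr 1; push_cast; ring
    rw [powMonoidHom_apply, h1, mul_div_cancel₀ _ hN, Circle.exp_arg]
  exact (powMonoidHom N : Circle →* Circle).measurePreserving (μ := μT) (ν := μT)
    (continuous_pow N) hs rfl

/-! ### The `*`-algebra `L^∞(𝕋)`, with pointwise (a.e.) operations -/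

/-- `L^∞(𝕋)`: essentially bounded measurable functions modulo a.e. equality.
Its additive group, scalar multiplication and `star` are those of Mathlib. -/
abbrev Linf : Type := Lp ℂ ∞ μT

namespace Linf

instance instMul : Mul Linf :=
  ⟨fun f g => ((Lp.memLp g).mul (Lp.memLp f) : MemLp (⇑f * ⇑g) ∞ μT).toLp (⇑f * ⇑g)⟩

instance instOne : One Linf :=
  ⟨(memLp_top_const (1 : ℂ) : MemLp (fun _ : Circle => (1 : ℂ)) ∞ μT).toLp _⟩

theorem coeFn_mul (f g : Linf) : ⇑(f * g) =ᵐ[μT] fun z => f z * g z :=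
  MemLp.coeFn_toLp _

theorem coeFn_one : ⇑(1 : Linf) =ᵐ[μT] fun _ => (1 : ℂ) :=
  MemLp.coeFn_toLp _

protected theorem mul_comm' (f g : Linf) : f * g = g * f := by
  apply Lp.ext
  filter_upwards [coeFn_mul f g, coeFn_mul g f] with z h1 h2
  rw [h1, h2, mul_comm]

protected theorem mul_assoc' (f g k : Linf) : f * g * k = f * (g * k) := by
  apply Lp.ext
  filter_upwards [coeFn_mul f g, coeFn_mul g k, coeFn_mul (f * g) k, coeFn_mul f (g * k)]
    with z h1 h2 h3 h4
  rw [h3, h4, h1, h2, mul_assoc]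

protected theorem one_mul' (f : Linf) : 1 * f = f := by
  apply Lp.ext
  filter_upwards [coeFn_mul 1 f, coeFn_one] with z h1 h2
  rw [h1, h2, one_mul]

protected theorem mul_add' (f g k : Linf) : f * (g + k) = f * g + f * k := by
  apply Lp.ext
  filter_upwards [coeFn_mul f (g + k), coeFn_mul f g, coeFn_mul f k, Lp.coeFn_add g k,
    Lp.coeFn_add (f * g) (f * k)] with z h1 h2 h3 h4 h5
  rw [h1, h4, h5, Pi.add_apply, Pi.add_apply, h2, h3, mul_add]

instance instCommRing : CommRing Linf :=
  { (inferInstance : AddCommGroup Linf), instMul, instOne with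
    mul_assoc := Linf.mul_assoc'
    one_mul := Linf.one_mul'
    mul_one := fun f => by rw [Linf.mul_comm', Linf.one_mul']
    mul_comm := Linf.mul_comm'
    left_distrib := Linf.mul_add'
    right_distrib := fun f g k => by
      rw [Linf.mul_comm', Linf.mul_add', Linf.mul_comm' k f, Linf.mul_comm' k g]
    zero_mul := fun f => by
      apply Lp.ext
      filter_upwards [coeFn_mul 0 f, Lp.coeFn_zero ℂ ∞ μT] with z h1 h2
      rw [h1, h2, Pi.zero_apply, zero_mul]
    mul_zero := fun f => by
      apply Lp.ext
      filter_upwards [coeFn_mul f 0, Lp.coeFn_zero ℂ ∞ μT] with z h1 h2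
      rw [h1, h2, Pi.zero_apply, mul_zero] }

instance instAlgebra : Algebra ℂ Linf :=
  Algebra.ofModule
    (fun c f g => by
      apply Lp.ext
      filter_upwards [coeFn_mul (c • f) g, Lp.coeFn_smul c f, Lp.coeFn_smul c (f * g),
        coeFn_mul f g] with z h1 h2 h3 h4
      rw [h1, h2, h3, Pi.smul_apply, Pi.smul_apply, h4, smul_mul_assoc])
    (fun c f g => by
      apply Lp.ext
      filter_upwards [coeFn_mul f (c • g), Lp.coeFn_smul c g, Lp.coeFn_smul c (f * g),
        coeFn_mul f g] with z h1 h2 h3 h4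
      rw [h1, h2, h3, Pi.smul_apply, Pi.smul_apply, h4, mul_smul_comm])

instance instStarRing : StarRing Linf where
  star_mul f g := by
    apply Lp.ext
    filter_upwards [Lp.coeFn_star (f * g), coeFn_mul f g, coeFn_mul (star g) (star f),
      Lp.coeFn_star f, Lp.coeFn_star g] with z h1 h2 h3 h4 h5
    rw [h1, h3, h4, h5, Pi.star_apply, Pi.star_apply, Pi.star_apply, h2, star_mul]
  star_add f g := by
    apply Lp.ext
    filter_upwards [Lp.coeFn_star (f + g), Lp.coeFn_add f g, Lp.coeFn_add (star f) (star g),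
      Lp.coeFn_star f, Lp.coeFn_star g] with z h1 h2 h3 h4 h5
    rw [h1, h3, Pi.star_apply, Pi.add_apply, h4, h5, Pi.star_apply, Pi.star_apply, h2,
      Pi.add_apply, star_add]

/-- The function `z ↦ f (z ^ N)`, for `f ∈ L^∞(𝕋)`. -/
def compPow (N : ℕ) [NeZero N] (f : Linf) : Linf :=
  Lp.compMeasurePreserving (fun z : Circle => z ^ N) (measurePreserving_pow N) f

theorem memLp_id : MemLp (fun z : Circle => (z : ℂ)) ∞ μT :=
  memLp_top_of_bound (Continuous.aestronglyMeasurable (by fun_prop)) 1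
    (Filter.Eventually.of_forall fun z => (Circle.norm_coe z).le)

/-- The identity function `z ↦ z`, as an element of `L^∞(𝕋)`. -/
def id : Linf := memLp_id.toLp _

theorem coeFn_id : ⇑id =ᵐ[μT] fun z : Circle => (z : ℂ) :=
  memLp_id.coeFn_toLp

theorem star_id_mul_id : star id * id = 1 := by
  apply Lp.ext
  filter_upwards [coeFn_mul (star id) id, Lp.coeFn_star id, coeFn_one,
    coeFn_id] with z h1 h2 h3 h4
  rw [h1, h2, h3, Pi.star_apply, h4, RCLike.star_def, mul_comm, Complex.mul_conj,
    Circle.normSq_coe, Complex.ofReal_one]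

/-- The identity function `z ↦ z`, as a unitary element of `L^∞(𝕋)`. -/
def unitaryId : unitary Linf :=
  ⟨id, Unitary.mem_iff.mpr ⟨star_id_mul_id, by rw [mul_comm]; exact star_id_mul_id⟩⟩

end Linf

/-! ### Filters -/

/-- The transfer operator `R_{m₀,m₀} f (z) = (1/N) ∑_{w^N = z} |m₀(w)|² f(w)`. -/
def transfer (N : ℕ) (m₀ : Linf) (f : Circle → ℝ) : Circle → ℝ := fun z =>
  (N : ℝ)⁻¹ * ∑ᶠ (w : Circle) (_ : w ^ N = z), ‖m₀ w‖ ^ 2 * f w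

/-- `m₀` is non-singular: its zero set has measure zero, and `|m₀|` is not a.e. equal to `1`. -/
def NonSingular (m₀ : Linf) : Prop :=
  (∀ᵐ z ∂μT, m₀ z ≠ 0) ∧ ¬ ∀ᵐ z ∂μT, ‖m₀ z‖ = 1

/-- The matrix `N^{-1/2} (m_i(ρ^j z))_{i,j}`, where `ρ = e^{2πi/N}`. -/
def filterMatrix {N : ℕ} (m : Fin N → Linf) (z : Circle) : Matrix (Fin N) (Fin N) ℂ :=
  Matrix.of fun i j => ((Real.sqrt N)⁻¹ : ℂ) * m i (Circle.exp (2 * Real.pi / N) ^ (j : ℕ) * z)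

/-- The matrix of the filters is unitary for almost every `z`. -/
def IsUnitaryFilterBank {N : ℕ} (m : Fin N → Linf) : Prop :=
  ∀ᵐ z ∂μT, filterMatrix m z ∈ Matrix.unitaryGroup (Fin N) ℂ

/-! ### Cyclic representations -/

variable {H : Type*} [NormedAddCommGroup H] [InnerProductSpace ℂ H]

/-- A family of vectors is an orthonormal basis of a closed subspace `V`:
it is orthonormal and its closed linear span is `V`. -/
def IsOrthonormalBasisOf {ι : Type*} (v : ι → H) (V : Submodule ℂ H) : Prop :=
  Orthonormal ℂ v ∧ (Submodule.span ℂ (Set.range v)).topologicalClosure = V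

variable [CompleteSpace H]

/-- `(U, π, H, φ)` is the cyclic representation associated to `h`; the quadruple is determined
by these properties up to unitary equivalence. Mathlib's inner product is linear in its second
argument. -/
structure IsCyclicRepresentation (N : ℕ) [NeZero N] (m₀ : Linf) (h : Circle → ℝ)
    (U : H ≃ₗᵢ[ℂ] H) (π : Linf →⋆ₐ[ℂ] (H →L[ℂ] H)) (φ : H) : Prop where
  cyclic : (Submodule.span ℂ {ξ : H | ∃ (n : ℕ) (f : Linf),
    ξ = (U ^ (-(n : ℤ)) : H ≃ₗᵢ[ℂ] H) (π f φ)}).topologicalClosure = ⊤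
  covariance : ∀ (f : Linf) (ξ : H), U (π f (U⁻¹ ξ)) = π (f.compPow N) ξ
  scaling : U φ = π m₀ φ
  inner_eq : ∀ f : Linf, inner ℂ φ (π f φ) = ∫ z, f z * (h z : ℂ) ∂μT

/-- The unitary operator `T = π(z)`. -/
def translation (π : Linf →⋆ₐ[ℂ] (H →L[ℂ] H)) : H ≃ₗᵢ[ℂ] H :=
  Unitary.linearIsometryEquiv (Unitary.map (StarMonoidHom.mk (π : Linf →* (H →L[ℂ] H)) (map_star π)) Linf.unitaryId)

theorem translation_apply (π : Linf →⋆ₐ[ℂ] (H →L[ℂ] H)) (ξ : H) :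
    translation π ξ = π Linf.id ξ := rfl

/-- `V_0`, the closed linear span of `{T^k φ | k ∈ ℤ}`. -/
def baseSpace (π : Linf →⋆ₐ[ℂ] (H →L[ℂ] H)) (φ : H) : Submodule ℂ H :=
  (Submodule.span ℂ (Set.range fun k : ℤ => (translation π ^ k) φ)).topologicalClosure

/-- `V_j = U^{-j} V_0`. -/
def resolutionSpace (U : H ≃ₗᵢ[ℂ] H) (π : Linf →⋆ₐ[ℂ] (H →L[ℂ] H)) (φ : H) (j : ℤ) :
    Submodule ℂ H :=
  (baseSpace π φ).map ((U ^ (-j) : H ≃ₗᵢ[ℂ] H).toLinearEquiv : H →ₗ[ℂ] H)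

/-- `ψ = U^{-1} π(m) φ`, for a filter `m`. -/
def wavelet (U : H ≃ₗᵢ[ℂ] H) (π : Linf →⋆ₐ[ℂ] (H →L[ℂ] H)) (φ : H) (m : Linf) : H :=
  U⁻¹ (π m φ)

end CyclicWavelet

end

/-! The vector `φ` has spectral measure `h μ`, so `π(f)φ ↦ f` identifies `V_0` with L²(h μ)
(`exists_isometry`), and there `U` becomes the isometry S : x ↦ m₀(z) x(z^N) (`cascade`). Hence U
V_0 ⊆ V_0, which gives the nesting. Density is cyclicity, because U^{-n} π(f)φ lies in `V_n`.

Trivial intersection. Ergodicity of z ↦ z^N leaves only h = 0 a.e., when H is trivial, or h > 0 a.e.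
In the latter case the intersection of the `V_j` corresponds to a subspace of the intersection of
the ranges of S^n. An element of the range of S^n is a fixed nonvanishing function times a function
of z^(N^n), so the quotient of two vectors common to all ranges is invariant under all N^n-th roots
of unity. These are dense, so the quotient is constant (`exists_eq_const_mul`). A nonzero common
vector x therefore satisfies S x = c x with |c| = 1, and u = |x|² h has fibre average u(z^N). A
variance argument makes u invariant (`comp_pow_eq_of_fiberAvg_eq`), which forces |m₀|² h = h(z^N).
If moreover R 1 = 1, the equality case of the harmonic–arithmetic mean inequality makes h invariant,
so |m₀| = 1 a.e., contradicting non-singularity (`not_quasiInvariant`).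

Bases for h = 1. Row orthogonality of the filter matrix makes the T^k U^{-1} π(m_i)φ orthonormal.
Column orthogonality gives a reconstruction formula, so they span `V_1`; the index 0 yields `V_0`
and the others its complement. Dilating, nesting gives orthogonality between levels, while trivial
intersection and dense union give completeness. -/

noncomputable section

namespace CyclicWavelet

open Filter Topology

/-! ### Roots of unity and averages over the fibres of `z ↦ z ^ N` -/

/-- The primitive root of unity `e^{2πi/N}`, as a point of the circle. -/
def rootOfUnity (N : ℕ) : Circle := Circle.exp (2 * Real.pi / N)

theorem isPrimitiveRoot_rootOfUnity (N : ℕ) [NeZero N] :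
    IsPrimitiveRoot ((rootOfUnity N : Circle) : ℂ) N := by
  have := Complex.isPrimitiveRoot_exp N (NeZero.ne N)
  convert this using 1
  rw [rootOfUnity, Circle.coe_exp]
  congr 1
  push_cast
  ring

theorem rootOfUnity_pow_pow (N : ℕ) [NeZero N] (j : ℕ) : (rootOfUnity N ^ j) ^ N = 1 := by
  apply Circle.ext
  rw [← pow_mul, mul_comm, pow_mul]
  push_cast
  rw [(isPrimitiveRoot_rootOfUnity N).pow_eq_one, one_pow]

theorem rootOfUnity_pow_mul_pow (N : ℕ) [NeZero N] (j : ℕ) (w : Circle) :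
    (rootOfUnity N ^ j * w) ^ N = w ^ N := by
  rw [mul_pow, rootOfUnity_pow_pow, one_mul]

theorem finsum_fiber {E : Type*} [AddCommMonoid E] (N : ℕ) [NeZero N] (f : Circle → E)
    (w : Circle) :
    ∑ᶠ (v : Circle) (_ : v ^ N = w ^ N), f v = ∑ j : Fin N, f (rootOfUnity N ^ (j : ℕ) * w) := by
  have hp := isPrimitiveRoot_rootOfUnity N
  have hinj : Function.Injective fun j : Fin N => rootOfUnity N ^ (j : ℕ) * w := by
    intro i j hij
    have h1 : rootOfUnity N ^ (i : ℕ) = rootOfUnity N ^ (j : ℕ) := mul_right_cancel hij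
    refine Fin.ext (hp.pow_inj i.2 j.2 ?_)
    simpa using congrArg (fun z : Circle => (z : ℂ)) h1
  have hrange : {v : Circle | v ^ N = w ^ N} =
      Set.range fun j : Fin N => rootOfUnity N ^ (j : ℕ) * w := by
    ext v
    constructor
    · intro hv
      have hv' : (v * w⁻¹) ^ N = 1 := by
        rw [mul_pow, inv_pow, show v ^ N = w ^ N from hv, mul_inv_cancel]
      obtain ⟨i, hi, h⟩ := hp.eq_pow_of_pow_eq_one (ξ := ((v * w⁻¹ : Circle) : ℂ))
        (by rw [← Circle.coe_pow, hv', Circle.coe_one])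
      refine ⟨⟨i, hi⟩, ?_⟩
      have : rootOfUnity N ^ i = v * w⁻¹ := Circle.ext (by simpa using h)
      simp [this]
    · rintro ⟨j, rfl⟩
      exact rootOfUnity_pow_mul_pow N j w
  have := finsum_mem_range (f := f) hinj
  rw [← hrange] at this
  rw [← finsum_eq_sum_of_fintype]
  exact this

/-- The average of `f` over the fibre of `z ↦ z ^ N` through `w`. -/
def fiberAvg (N : ℕ) (f : Circle → ℝ) (w : Circle) : ℝ :=
  (N : ℝ)⁻¹ * ∑ j : Fin N, f (rootOfUnity N ^ (j : ℕ) * w)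

/-- Evaluating at w^N supplies a base point for the fibre, so identities for the transfer operator
are studied upstairs without choosing an N-th root. -/
theorem transfer_pow (N : ℕ) [NeZero N] (m₀ : Linf) (f : Circle → ℝ) (w : Circle) :
    transfer N m₀ f (w ^ N) = fiberAvg N (fun v => ‖m₀ v‖ ^ 2 * f v) w := by
  rw [transfer, fiberAvg, finsum_fiber N (fun v => ‖m₀ v‖ ^ 2 * f v)]

theorem ae_pow {N : ℕ} [NeZero N] {p : Circle → Prop} (hp : ∀ᵐ z ∂μT, p z) :
    ∀ᵐ z ∂μT, p (z ^ N) :=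
  (measurePreserving_pow N).quasiMeasurePreserving.ae hp

theorem measurePreserving_mul (a : Circle) : MeasurePreserving (fun z => a * z) μT μT :=
  measurePreserving_mul_left μT a

theorem ae_mul {p : Circle → Prop} (a : Circle) (hp : ∀ᵐ z ∂μT, p z) :
    ∀ᵐ z ∂μT, p (a * z) :=
  (measurePreserving_mul a).quasiMeasurePreserving.ae hp

theorem ae_fiber {p : Circle → Prop} (N : ℕ) (hp : ∀ᵐ z ∂μT, p z) :
    ∀ᵐ z ∂μT, ∀ j : Fin N, p (rootOfUnity N ^ (j : ℕ) * z) :=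
  ae_all_iff.mpr fun _ => ae_mul _ hp

theorem integral_comp_mul {E : Type*} [NormedAddCommGroup E] [NormedSpace ℝ E]
    (f : Circle → E) (a : Circle) : ∫ z, f (a * z) ∂μT = ∫ z, f z ∂μT :=
  integral_mul_left_eq_self f a

theorem Integrable.comp_mul {E : Type*} [NormedAddCommGroup E] {f : Circle → E}
    (hf : Integrable f μT) (a : Circle) : Integrable (fun z => f (a * z)) μT :=
  (measurePreserving_mul a).integrable_comp_of_integrable hf

theorem Integrable.comp_pow' {E : Type*} [NormedAddCommGroup E] {f : Circle → E}
    (hf : Integrable f μT) (N : ℕ) [NeZero N] : Integrable (fun z => f (z ^ N)) μT :=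
  (measurePreserving_pow N).integrable_comp_of_integrable hf

theorem integral_comp_pow {f : Circle → ℝ} (hf : AEStronglyMeasurable f μT) (N : ℕ) [NeZero N] :
    ∫ z, f (z ^ N) ∂μT = ∫ z, f z ∂μT := by
  have h := (measurePreserving_pow N)
  conv_rhs => rw [← h.map_eq]
  rw [integral_map h.measurable.aemeasurable (by rwa [h.map_eq])]

theorem Integrable.fiberAvg {N : ℕ} {f : Circle → ℝ} (hf : Integrable f μT) :
    Integrable (fiberAvg N f) μT :=
  (integrable_finsetSum _ fun _ _ => Integrable.comp_mul hf _).const_mul _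

theorem integral_fiberAvg {N : ℕ} [NeZero N] {f : Circle → ℝ} (hf : Integrable f μT) :
    ∫ z, fiberAvg N f z ∂μT = ∫ z, f z ∂μT := by
  unfold CyclicWavelet.fiberAvg
  rw [integral_const_mul, integral_finsetSum _ fun _ _ => Integrable.comp_mul hf _]
  simp_rw [integral_comp_mul]
  have : (N : ℝ) ≠ 0 := Nat.cast_ne_zero.mpr (NeZero.ne N)
  simp [this]

theorem lintegral_fiber {N : ℕ} [NeZero N] {f : Circle → ℝ≥0∞} (hf : AEMeasurable f μT) :
    ∫⁻ z, f z ∂μT = (N : ℝ≥0∞)⁻¹ * ∫⁻ z, ∑ j : Fin N, f (rootOfUnity N ^ (j : ℕ) * z) ∂μT := by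
  have hm : ∀ j : Fin N, AEMeasurable (fun z => f (rootOfUnity N ^ (j : ℕ) * z)) μT := fun j =>
    hf.comp_quasiMeasurePreserving (measurePreserving_mul _).quasiMeasurePreserving
  rw [lintegral_finsetSum' _ fun j _ => hm j]
  simp_rw [lintegral_mul_left_eq_self]
  have : (N : ℝ≥0∞) ≠ 0 := Nat.cast_ne_zero.mpr (NeZero.ne N)
  simp [← mul_assoc, ENNReal.inv_mul_cancel this (ENNReal.natCast_ne_top N)]

/-! ### Ergodicity -/

theorem dense_setOf_pow_pow_eq_one {N : ℕ} (hN : 2 ≤ N) :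
    Dense {ζ : Circle | ∃ n : ℕ, ζ ^ N ^ n = 1} := by
  -- Lifted to ℝ, these roots of unity form a subgroup, which is dense because it contains the
  -- arbitrarily small elements 2π / N^n.
  let S : AddSubgroup ℝ :=
    { carrier := {x | ∃ n : ℕ, Circle.exp x ^ N ^ n = 1}
      zero_mem' := ⟨0, by simp⟩
      add_mem' := by
        rintro x y ⟨n, hn⟩ ⟨k, hk⟩
        refine ⟨n + k, ?_⟩
        rw [Circle.exp_add, mul_pow, pow_add, pow_mul, hn, one_pow, one_mul, mul_comm, pow_mul, hk,
          one_pow]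
      neg_mem' := by
        rintro x ⟨n, hn⟩
        exact ⟨n, by rw [Circle.exp_neg, inv_pow, hn, inv_one]⟩ }
  have hS : Dense (S : Set ℝ) := by
    refine S.dense_of_not_isolated_zero fun ε hε => ?_
    have hN1 : (1 : ℝ) < N := by exact_mod_cast hN
    obtain ⟨n, hn⟩ := pow_unbounded_of_one_lt (2 * Real.pi / ε) hN1
    have hpos : (0 : ℝ) < (N : ℝ) ^ n := by positivity
    refine ⟨2 * Real.pi / (N : ℝ) ^ n, ⟨n, ?_⟩, ⟨by positivity, ?_⟩⟩
    · have : NeZero (N ^ n) := ⟨by positivity⟩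
      have h := rootOfUnity_pow_pow (N ^ n) 1
      rw [pow_one, rootOfUnity] at h
      simpa using h
    · rw [div_lt_iff₀ hpos]
      rw [div_lt_iff₀ hε] at hn
      linarith
  have hd : DenseRange (Circle.exp : ℝ → Circle) :=
    Function.Surjective.denseRange fun z => ⟨_, Circle.exp_arg z⟩
  refine (hd.dense_image Circle.exp.continuous hS).mono ?_
  rintro _ ⟨x, hx, rfl⟩
  exact hx

instance instInnerRegular : μT.InnerRegular := by unfold μT; infer_instance

theorem ergodic_pow {N : ℕ} (hN : 2 ≤ N) : Ergodic (fun z : Circle => z ^ N) μT := by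
  have : NeZero N := ⟨by omega⟩
  refine ⟨measurePreserving_pow N,
    (powMonoidHom N : Circle →* Circle).preErgodic_of_dense_iUnion_preimage_one ?_⟩
  refine (dense_setOf_pow_pow_eq_one hN).mono ?_
  rintro ζ ⟨n, hn⟩
  refine Set.mem_iUnion.mpr ⟨n, ?_⟩
  have : ((powMonoidHom N : Circle →* Circle))^[n] ζ = ζ ^ N ^ n := by
    change (fun z : Circle => z ^ N)^[n] ζ = _
    rw [pow_iterate]
  rw [Set.mem_preimage, this, hn]
  rfl

/-- The preimage of each Borel set is invariant under a dense set of rotations, hence null or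
conull; Borel sets separate the points of ℂ countably, so `f` concentrates at one value. -/
theorem exists_ae_eq_const {N : ℕ} (hN : 2 ≤ N) {f : Circle → ℂ} (hf : AEMeasurable f μT)
    (hinv : ∀ (n : ℕ) (ζ : Circle), ζ ^ N ^ n = 1 → ∀ᵐ z ∂μT, f (ζ * z) = f z) :
    ∃ c : ℂ, ∀ᵐ z ∂μT, f z = c := by
  refine exists_eventuallyEq_const_of_forall_separating (f := f) (l := ae μT) MeasurableSet
    fun B hB => ?_
  have hnull : NullMeasurableSet (f ⁻¹' B) μT := hf.nullMeasurable hB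
  have := aeconst_of_dense_setOfPred_preimage_smul_ae (M := Circle) hnull
    ((dense_setOf_pow_pow_eq_one hN).mono ?_)
  · rcases eventuallyConst_set.mp this with h | h
    · exact Or.inl h
    · exact Or.inr h
  · rintro ζ ⟨n, hn⟩
    change (fun x => ζ • x) ⁻¹' (f ⁻¹' B) =ᵐ[μT] f ⁻¹' B
    refine eventuallyEq_set.mpr ?_
    filter_upwards [hinv n ζ hn] with z hz
    simp [hz]

/-! ### Rigidity of nonnegative functions under averaging -/

/-- A nonnegative function fixed by the unweighted transfer operator is invariant. -/
theorem comp_pow_eq_of_fiberAvg_eq {N : ℕ} [NeZero N] {u : Circle → ℝ} (hu : Integrable u μT)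
    (h0 : ∀ᵐ z ∂μT, 0 ≤ u z) (havg : ∀ᵐ z ∂μT, fiberAvg N u z = u (z ^ N)) :
    ∀ᵐ z ∂μT, u z = u (z ^ N) := by
  -- `u` is only integrable, so the variance argument runs on its square root: the fibre average of
  -- v² is v(z^N)², and expanding the squares leaves a multiple of v(z^N) minus the average of v,
  -- whose integral is zero.
  set v : Circle → ℝ := fun z => √(u z) with hv
  have hN : (0 : ℝ) < N := Nat.cast_pos.mpr (NeZero.pos N)
  have hvint : Integrable v μT := by
    have hm : AEStronglyMeasurable v μT := Real.continuous_sqrt.comp_aestronglyMeasurable hu.1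
    refine Integrable.mono' (hu.norm.add (integrable_const 1)) hm (Eventually.of_forall fun z => ?_)
    simp only [hv, Pi.add_apply, Real.norm_eq_abs, abs_of_nonneg (Real.sqrt_nonneg _)]
    refine Real.sqrt_le_iff.mpr ⟨by positivity, ?_⟩
    nlinarith [le_abs_self (u z), abs_nonneg (u z)]
  have hsq : ∀ᵐ z ∂μT, ∑ j : Fin N, (v (rootOfUnity N ^ (j : ℕ) * z) - v (z ^ N)) ^ 2
      = 2 * N * v (z ^ N) * (v (z ^ N) - fiberAvg N v z) := by
    filter_upwards [ae_fiber N h0, ae_pow (N := N) h0, havg] with z h1 h2 h3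
    have e1 : ∑ j : Fin N, v (rootOfUnity N ^ (j : ℕ) * z) = N * fiberAvg N v z := by
      rw [fiberAvg]; field_simp
    have e2 : ∑ j : Fin N, v (rootOfUnity N ^ (j : ℕ) * z) ^ 2 = N * v (z ^ N) ^ 2 := by
      rw [show v (z ^ N) ^ 2 = fiberAvg N u z by rw [h3]; exact Real.sq_sqrt h2, fiberAvg,
        mul_inv_cancel_left₀ hN.ne']
      exact Finset.sum_congr rfl fun j _ => Real.sq_sqrt (h1 j)
    simp_rw [sub_sq]
    rw [Finset.sum_add_distrib, Finset.sum_sub_distrib, ← Finset.sum_mul, ← Finset.mul_sum, e1, e2]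
    simp
    ring
  have hle : ∀ᵐ z ∂μT, 0 ≤ v (z ^ N) - fiberAvg N v z := by
    filter_upwards [hsq] with z hz
    have h1 : 0 ≤ ∑ j : Fin N, (v (rootOfUnity N ^ (j : ℕ) * z) - v (z ^ N)) ^ 2 :=
      Finset.sum_nonneg fun j _ => sq_nonneg _
    -- Where v(z^N) = 0 the identity cannot be divided by it; there the sum of squares vanishes and
    -- with it the average.
    rcases (Real.sqrt_nonneg (u (z ^ N))).eq_or_lt with h2 | h2
    · have hz' : v (z ^ N) = 0 := h2.symm
      simp only [hz', mul_zero, zero_mul, sub_zero] at hz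
      rw [Finset.sum_eq_zero_iff_of_nonneg fun j _ => sq_nonneg _] at hz
      have : fiberAvg N v z = 0 := by
        rw [fiberAvg, Finset.sum_eq_zero, mul_zero]
        exact fun j hj => pow_eq_zero_iff two_ne_zero |>.mp (hz j hj)
      simp [hz', this]
    · by_contra hneg
      push Not at hneg
      have : 2 * N * v (z ^ N) * (v (z ^ N) - fiberAvg N v z) < 0 :=
        mul_neg_of_pos_of_neg (mul_pos (by positivity) h2) hneg
      linarith
  have hint : ∫ z, (v (z ^ N) - fiberAvg N v z) ∂μT = 0 := by
    rw [integral_sub (Integrable.comp_pow' hvint N) (Integrable.fiberAvg hvint),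
      integral_fiberAvg hvint, integral_comp_pow hvint.1, sub_self]
  have hzero := (integral_eq_zero_iff_of_nonneg_ae hle
    ((Integrable.comp_pow' hvint N).sub (Integrable.fiberAvg hvint))).mp hint
  filter_upwards [hsq, hzero, h0, ae_pow (N := N) h0] with z h1 h2 h3 h4
  simp only [Pi.zero_apply] at h2
  rw [h2, mul_zero, Finset.sum_eq_zero_iff_of_nonneg fun j _ => sq_nonneg _] at h1
  have := h1 ⟨0, NeZero.pos N⟩ (Finset.mem_univ _)
  simp only [pow_zero, one_mul, pow_eq_zero_iff two_ne_zero] at this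
  exact (Real.sqrt_inj h3 h4).mp (sub_eq_zero.mp this)

/-- The equality case of the inequality between the harmonic and the arithmetic mean. -/
theorem comp_pow_eq_of_fiberAvg_inv_eq {N : ℕ} [NeZero N] {u : Circle → ℝ}
    (hu : Integrable u μT) (h0 : ∀ᵐ z ∂μT, 0 < u z)
    (havg : ∀ᵐ z ∂μT, fiberAvg N (fun w => (u w)⁻¹) z = (u (z ^ N))⁻¹) :
    ∀ᵐ z ∂μT, u z = u (z ^ N) := by
  have hN : (0 : ℝ) < N := Nat.cast_pos.mpr (NeZero.pos N)
  -- Weighting the squares by 1/u makes the hypothesis on the average of 1/u apply after expansion.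
  -- The right-hand side again has integral zero.
  have hsq : ∀ᵐ z ∂μT, ∑ j : Fin N, (u (rootOfUnity N ^ (j : ℕ) * z) - u (z ^ N)) ^ 2 *
      (u (rootOfUnity N ^ (j : ℕ) * z))⁻¹ = N * (fiberAvg N u z - u (z ^ N)) := by
    filter_upwards [ae_fiber N h0, ae_pow (N := N) h0, havg] with z h1 h2 h3
    have e1 : ∑ j : Fin N, u (rootOfUnity N ^ (j : ℕ) * z) = N * fiberAvg N u z := by
      rw [fiberAvg]; field_simp
    have e2 : ∑ j : Fin N, (u (rootOfUnity N ^ (j : ℕ) * z))⁻¹ = N * (u (z ^ N))⁻¹ := by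
      rw [← h3, fiberAvg, mul_inv_cancel_left₀ hN.ne']
    have e3 : ∀ j : Fin N, (u (rootOfUnity N ^ (j : ℕ) * z) - u (z ^ N)) ^ 2 *
        (u (rootOfUnity N ^ (j : ℕ) * z))⁻¹ = u (rootOfUnity N ^ (j : ℕ) * z) - 2 * u (z ^ N)
          + u (z ^ N) ^ 2 * (u (rootOfUnity N ^ (j : ℕ) * z))⁻¹ := fun j => by
      have := (h1 j).ne'
      field_simp
      ring
    simp_rw [e3]
    rw [Finset.sum_add_distrib, Finset.sum_sub_distrib, ← Finset.mul_sum, ← Finset.mul_sum, e1, e2]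
    simp only [Finset.sum_const, Finset.card_univ, Fintype.card_fin, nsmul_eq_mul]
    field_simp
    ring
  have hle : ∀ᵐ z ∂μT, 0 ≤ fiberAvg N u z - u (z ^ N) := by
    filter_upwards [hsq, ae_fiber N h0] with z hz h1
    refine nonneg_of_mul_nonneg_right (hz ▸ ?_) hN
    exact Finset.sum_nonneg fun j _ => mul_nonneg (sq_nonneg _) (inv_nonneg.mpr (h1 j).le)
  have hint : ∫ z, (fiberAvg N u z - u (z ^ N)) ∂μT = 0 := by
    rw [integral_sub (Integrable.fiberAvg hu) (Integrable.comp_pow' hu N),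
      integral_fiberAvg hu, integral_comp_pow hu.1, sub_self]
  have hzero := (integral_eq_zero_iff_of_nonneg_ae hle
    ((Integrable.fiberAvg hu).sub (Integrable.comp_pow' hu N))).mp hint
  filter_upwards [hsq, hzero, ae_fiber N h0] with z h1 h2 h3
  simp only [Pi.zero_apply] at h2
  rw [h2, mul_zero, Finset.sum_eq_zero_iff_of_nonneg fun j _ =>
    mul_nonneg (sq_nonneg _) (inv_nonneg.mpr (h3 j).le)] at h1
  have h4 := h1 ⟨0, NeZero.pos N⟩ (Finset.mem_univ _)
  have h5 := h3 ⟨0, NeZero.pos N⟩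
  simp only [pow_zero, one_mul] at h4 h5
  have := (mul_eq_zero.mp h4).resolve_right (inv_ne_zero h5.ne')
  exact sub_eq_zero.mp (pow_eq_zero_iff two_ne_zero |>.mp this)

/-! ### Characters of the circle -/

/-- The character `z ↦ z ^ k` of the circle, as a continuous complex function. -/
def character (k : ℤ) : C(Circle, ℂ) := 
  ⟨fun z => ((z ^ k : Circle) : ℂ), continuous_subtype_val.comp (continuous_zpow k)⟩

theorem span_character_closure_eq_top :
    (Submodule.span ℂ (Set.range character)).topologicalClosure = ⊤ := by
  have : Fact (0 < 2 * Real.pi) := ⟨by positivity⟩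
  let e := AddCircle.homeomorphCircle (T := 2 * Real.pi) (by positivity)
  let Φ : C(AddCircle (2 * Real.pi), ℂ) →L[ℂ] C(Circle, ℂ) :=
    { toFun := fun f => f.comp ⟨e.symm, e.symm.continuous⟩
      map_add' := fun _ _ => rfl
      map_smul' := fun _ _ => rfl
      cont := ContinuousMap.continuous_precomp _ }
  have hsurj : Function.Surjective Φ := fun f =>
    ⟨f.comp ⟨e, e.continuous⟩, by ext z; simp [Φ]⟩
  have h := hsurj.denseRange.topologicalClosure_map_submodule
    (span_fourier_closure_eq_top (T := 2 * Real.pi))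
  rw [Submodule.map_span, ← Set.range_comp] at h
  rw [← h]
  congr 3
  funext k
  ext z
  obtain ⟨x, rfl⟩ := e.surjective z
  have he : e x = AddCircle.toCircle x := AddCircle.homeomorphCircle_apply _ x
  change ((e x ^ k : Circle) : ℂ) = fourier k (e.symm (e x))
  rw [e.symm_apply_apply, fourier_apply, AddCircle.toCircle_zsmul, he]

theorem integral_character (k : ℤ) :
    ∫ z : Circle, ((z ^ k : Circle) : ℂ) ∂μT = if k = 0 then 1 else 0 := by
  split_ifs with hk
  · simp [hk]
  · set I := ∫ z : Circle, ((z ^ k : Circle) : ℂ) ∂μT with hI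
    -- Rotation by `a` changes the sign of z^k but not its integral.
    let a : Circle := Circle.exp (Real.pi / k)
    have ha : ((a ^ k : Circle) : ℂ) = -1 := by
      have hk' : (k : ℝ) ≠ 0 := by exact_mod_cast hk
      have : a ^ k = Circle.exp Real.pi := by
        change Circle.exp (Real.pi / k) ^ k = _
        rw [← Circle.exp_intCast_mul]
        congr 1
        field_simp
      rw [this]
      simp
    have h1 := integral_comp_mul (fun z : Circle => ((z ^ k : Circle) : ℂ)) a
    simp_rw [mul_zpow, Circle.coe_mul, ha] at h1
    rw [integral_const_mul, ← hI] at h1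
    linear_combination (-1 / 2 : ℂ) * h1

/-! ### Characters in `L^∞` and the powers of the translation operator -/

/-- The character `z ↦ z ^ k`, as an element of `L^∞(𝕋)`. -/
def charLinf (k : ℤ) : Linf := ContinuousMap.toLp ∞ μT ℂ (character k)

theorem coeFn_charLinf (k : ℤ) : ⇑(charLinf k) =ᵐ[μT] fun z => ((z ^ k : Circle) : ℂ) :=
  ContinuousMap.coeFn_toLp μT (character k)

theorem charLinf_add (j k : ℤ) : charLinf (j + k) = charLinf j * charLinf k := by
  apply Lp.ext
  filter_upwards [coeFn_charLinf (j + k), coeFn_charLinf j, coeFn_charLinf k,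
    Linf.coeFn_mul (charLinf j) (charLinf k)] with z h1 h2 h3 h4
  rw [h1, h4, h2, h3, zpow_add, Circle.coe_mul]

theorem charLinf_one : charLinf 1 = Linf.id := by
  apply Lp.ext
  filter_upwards [coeFn_charLinf 1, Linf.coeFn_id] with z h1 h2
  rw [h1, h2, zpow_one]

theorem charLinf_zero : charLinf 0 = 1 := by
  apply Lp.ext
  filter_upwards [coeFn_charLinf 0, Linf.coeFn_one] with z h1 h2
  rw [h1, h2, zpow_zero, Circle.coe_one]

theorem star_charLinf (k : ℤ) : star (charLinf k) = charLinf (-k) := by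
  apply Lp.ext
  filter_upwards [coeFn_charLinf k, coeFn_charLinf (-k), Lp.coeFn_star (charLinf k)] with z h1 h2 h3
  rw [h2, h3, Pi.star_apply, h1, zpow_neg, Circle.coe_inv_eq_conj, RCLike.star_def]

theorem coeFn_compPow (N : ℕ) [NeZero N] (f : Linf) :
    ⇑(f.compPow N) =ᵐ[μT] fun z => f (z ^ N) :=
  Lp.coeFn_compMeasurePreserving f (measurePreserving_pow N)

theorem compPow_charLinf (N : ℕ) [NeZero N] (k : ℤ) :
    (charLinf k).compPow N = charLinf (N * k) := by
  apply Lp.ext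
  filter_upwards [coeFn_compPow N (charLinf k), coeFn_charLinf (N * k),
    ae_pow (N := N) (coeFn_charLinf k)] with z h1 h2 h3
  rw [h1, h2, h3, zpow_mul, zpow_natCast]

variable {H : Type*} [NormedAddCommGroup H] [InnerProductSpace ℂ H] [CompleteSpace H]

theorem map_mul_apply (π : Linf →⋆ₐ[ℂ] (H →L[ℂ] H)) (f g : Linf) (ξ : H) :
    π (f * g) ξ = π f (π g ξ) := by
  rw [map_mul]; rfl

theorem translation_zpow_apply (π : Linf →⋆ₐ[ℂ] (H →L[ℂ] H)) (k : ℤ) (ξ : H) :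
    (translation π ^ k) ξ = π (charLinf k) ξ := by
  induction k generalizing ξ with
  | zero => rw [zpow_zero, charLinf_zero, map_one]; rfl
  | succ k ih =>
    rw [zpow_add_one, charLinf_add, map_mul_apply, LinearIsometryEquiv.coe_mul,
      Function.comp_apply, ih, translation_apply, charLinf_one]
  | pred k ih =>
    obtain ⟨η, rfl⟩ := (translation π).surjective ξ
    have h1 : (translation π ^ (-(k : ℤ) - 1)) (translation π η) =
        (translation π ^ (-(k : ℤ))) η := by
      conv_rhs => rw [← sub_add_cancel (-(k : ℤ)) 1, zpow_add_one]
      rfl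
    rw [h1, ih, translation_apply, ← charLinf_one, ← map_mul_apply, ← charLinf_add, sub_add_cancel]

theorem inner_map_apply (π : Linf →⋆ₐ[ℂ] (H →L[ℂ] H)) (f g : Linf) (ξ : H) :
    inner ℂ (π f ξ) (π g ξ) = inner ℂ ξ (π (star f * g) ξ) := by
  rw [map_mul_apply, map_star, ContinuousLinearMap.star_eq_adjoint,
    ContinuousLinearMap.adjoint_inner_right]

/-! ### The space `V_0` as a weighted `L²` space -/

/-- The measure `h μ` on the circle. -/
def weighted (h : Circle → ℝ) : Measure Circle := μT.withDensity fun z => ENNReal.ofReal (h z)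

theorem weighted_absolutelyContinuous (h : Circle → ℝ) : weighted h ≪ μT :=
  withDensity_absolutelyContinuous _ _

theorem isFiniteMeasure_weighted {h : Circle → ℝ} (h_int : Integrable h μT) :
    IsFiniteMeasure (weighted h) :=
  isFiniteMeasure_withDensity_ofReal h_int.2

theorem memLp_weighted (h : Circle → ℝ) [IsFiniteMeasure (weighted h)] (f : Linf) :
    MemLp f 2 (weighted h) := by
  have h1 : MemLp f ∞ (weighted h) :=
    ⟨(Lp.aestronglyMeasurable f).mono_ac (weighted_absolutelyContinuous h),
      (eLpNorm_exponent_top (f := f) (μ := weighted h) ▸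
        eLpNormEssSup_mono_measure f (weighted_absolutelyContinuous h)).trans_lt
        (by rw [← eLpNorm_exponent_top]; exact (Lp.memLp f).2)⟩
  exact h1.mono_exponent le_top

/-- The canonical map from `L^∞(μ)` to `L²(h μ)`. -/
def toWeighted (h : Circle → ℝ) [IsFiniteMeasure (weighted h)] :
    Linf →ₗ[ℂ] Lp ℂ 2 (weighted h) where
  toFun f := (memLp_weighted h f).toLp f
  map_add' f g := by
    rw [← MemLp.toLp_add]
    exact MemLp.toLp_congr _ _ ((weighted_absolutelyContinuous h).ae_eq (Lp.coeFn_add f g))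
  map_smul' c f := by
    rw [RingHom.id_apply, ← MemLp.toLp_const_smul c (memLp_weighted h f)]
    exact MemLp.toLp_congr _ ((memLp_weighted h f).const_smul c)
      ((weighted_absolutelyContinuous h).ae_eq (Lp.coeFn_smul c f))

theorem coeFn_toWeighted (h : Circle → ℝ) [IsFiniteMeasure (weighted h)] (f : Linf) :
    ⇑(toWeighted h f) =ᵐ[weighted h] f :=
  (memLp_weighted h f).coeFn_toLp

theorem toWeighted_charLinf (h : Circle → ℝ) [IsFiniteMeasure (weighted h)] (k : ℤ) :
    toWeighted h (charLinf k) = ContinuousMap.toLp 2 (weighted h) ℂ (character k) := by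
  apply Lp.ext
  filter_upwards [coeFn_toWeighted h (charLinf k),
    ContinuousMap.coeFn_toLp (p := 2) (𝕜 := ℂ) (weighted h) (character k),
    (weighted_absolutelyContinuous h).ae_le (coeFn_charLinf k)] with z h1 h2 h3
  rw [h1, h2, h3]
  rfl

theorem span_toWeighted_charLinf_closure_eq_top (h : Circle → ℝ) [IsFiniteMeasure (weighted h)] :
    (Submodule.span ℂ (Set.range fun k => toWeighted h (charLinf k))).topologicalClosure = ⊤ := by
  have := (ContinuousMap.toLp_denseRange (p := 2) ℂ (weighted h) ℂ
    (by norm_num)).topologicalClosure_map_submodule span_character_closure_eq_top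
  rw [Submodule.map_span, ← Set.range_comp] at this
  simpa only [toWeighted_charLinf] using! this

theorem denseRange_toWeighted (h : Circle → ℝ) [IsFiniteMeasure (weighted h)] :
    DenseRange (toWeighted h) := by
  have h1 := span_toWeighted_charLinf_closure_eq_top h
  rw [← Submodule.dense_iff_topologicalClosure_eq_top] at h1
  refine h1.mono ?_
  rw [← LinearMap.coe_range, SetLike.coe_subset_coe, Submodule.span_le]
  rintro _ ⟨k, rfl⟩
  exact ⟨_, rfl⟩

theorem integral_weighted {h : Circle → ℝ} (h_int : Integrable h μT)
    (h_nonneg : ∀ᵐ z ∂μT, 0 ≤ h z) (f : Circle → ℂ) :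
    ∫ z, f z ∂weighted h = ∫ z, f z * (h z : ℂ) ∂μT := by
  rw [weighted, integral_withDensity_eq_integral_toReal_smul₀ h_int.1.aemeasurable.ennreal_ofReal
    (Eventually.of_forall fun _ => ENNReal.ofReal_lt_top)]
  refine integral_congr_ae ?_
  filter_upwards [h_nonneg] with z hz
  rw [ENNReal.toReal_ofReal hz, Complex.real_smul, mul_comm]

namespace IsCyclicRepresentation

variable {N : ℕ} [NeZero N] {m₀ : Linf} {h : Circle → ℝ} {U : H ≃ₗᵢ[ℂ] H}
  {π : Linf →⋆ₐ[ℂ] (H →L[ℂ] H)} {φ : H}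

theorem norm_map_apply (hrep : IsCyclicRepresentation N m₀ h U π φ) (h_int : Integrable h μT)
    (h_nonneg : ∀ᵐ z ∂μT, 0 ≤ h z) [IsFiniteMeasure (weighted h)] (f : Linf) :
    ‖π f φ‖ = ‖toWeighted h f‖ := by
  have : inner ℂ (π f φ) (π f φ) = inner ℂ (toWeighted h f) (toWeighted h f) := by
    rw [inner_map_apply, hrep.inner_eq, ← integral_weighted h_int h_nonneg, L2.inner_def]
    refine integral_congr_ae ?_
    filter_upwards [coeFn_toWeighted h f,
      (weighted_absolutelyContinuous h).ae_le (Linf.coeFn_mul (star f) f),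
      (weighted_absolutelyContinuous h).ae_le (Lp.coeFn_star f)] with z h1 h2 h3
    rw [h1, h2, h3, Pi.star_apply, RCLike.inner_apply, RCLike.star_def, mul_comm]
  rw [inner_self_eq_norm_sq_to_K, inner_self_eq_norm_sq_to_K] at this
  have h2 : ‖π f φ‖ ^ 2 = ‖toWeighted h f‖ ^ 2 := by exact_mod_cast this
  exact (sq_eq_sq₀ (norm_nonneg _) (norm_nonneg _)).mp h2

/-- The map `f ↦ π(f) φ` on `L^∞`. -/
def orbitMap (π : Linf →⋆ₐ[ℂ] (H →L[ℂ] H)) (φ : H) : Linf →ₗ[ℂ] H where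
  toFun f := π f φ
  map_add' f g := by simp
  map_smul' c f := by simp

/-- There is an isometry from `L²(h μ)` onto `V_0` that extends `f ↦ π(f) φ`. -/
theorem exists_isometry (hrep : IsCyclicRepresentation N m₀ h U π φ) (h_int : Integrable h μT)
    (h_nonneg : ∀ᵐ z ∂μT, 0 ≤ h z) [IsFiniteMeasure (weighted h)] :
    ∃ J : Lp ℂ 2 (weighted h) →ₗᵢ[ℂ] H, (∀ f : Linf, J (toWeighted h f) = π f φ) ∧
      Set.range J = baseSpace π φ := by
  have hnorm := hrep.norm_map_apply h_int h_nonneg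
  have hd := denseRange_toWeighted h
  set J₀ : Lp ℂ 2 (weighted h) →L[ℂ] H := (orbitMap π φ).extendOfNorm (toWeighted h) with hJ₀
  have hJ : ∀ f, J₀ (toWeighted h f) = π f φ := fun f =>
    LinearMap.extendOfNorm_eq hd ⟨1, fun f => by rw [one_mul, ← hnorm f]; rfl⟩ f
  have hiso : ∀ x, ‖J₀ x‖ = ‖x‖ := fun x =>
    hd.induction_on x (isClosed_eq J₀.continuous.norm continuous_norm)
      fun f => by rw [hJ, hnorm]
  let J : Lp ℂ 2 (weighted h) →ₗᵢ[ℂ] H := ⟨J₀.toLinearMap, hiso⟩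
  refine ⟨J, hJ, ?_⟩
  have hce : IsClosedEmbedding J := J.isometry.isClosedEmbedding
  have h1 : (Set.range fun k : ℤ => (translation π ^ k) φ) =
      (J.toLinearMap : Lp ℂ 2 (weighted h) → H) '' Set.range fun k => toWeighted h (charLinf k) := by
    rw [← Set.range_comp]
    congr 1
    funext k
    rw [translation_zpow_apply]
    exact (hJ _).symm
  rw [baseSpace, h1, ← Submodule.map_span, Submodule.topologicalClosure_coe, Submodule.map_coe]
  change _ = closure (J '' _)
  rw [hce.closure_image_eq, ← Submodule.topologicalClosure_coe,
    span_toWeighted_charLinf_closure_eq_top, Submodule.top_coe, Set.image_univ]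

/-- `V_0` is generated by characters alone; density of trigonometric polynomials in L²(h μ), built
into the isometry, brings in every bounded `f`. -/
theorem map_apply_mem_baseSpace (hrep : IsCyclicRepresentation N m₀ h U π φ)
    (h_int : Integrable h μT) (h_nonneg : ∀ᵐ z ∂μT, 0 ≤ h z) (f : Linf) :
    π f φ ∈ baseSpace π φ := by
  have := isFiniteMeasure_weighted h_int
  obtain ⟨J, hJ, hr⟩ := hrep.exists_isometry h_int h_nonneg
  rw [← SetLike.mem_coe, ← hr, ← hJ]
  exact ⟨_, rfl⟩

theorem apply_map_apply (hrep : IsCyclicRepresentation N m₀ h U π φ) (f : Linf) :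
    U (π f φ) = π (f.compPow N * m₀) φ := by
  have := hrep.covariance f (U φ)
  rw [hrep.scaling] at this
  rw [map_mul_apply, ← this, ← hrep.scaling]
  congr 3
  exact (U.symm_apply_apply φ).symm

end IsCyclicRepresentation

/-! ### The multiresolution -/

theorem mem_resolutionSpace_iff {U : H ≃ₗᵢ[ℂ] H} {π : Linf →⋆ₐ[ℂ] (H →L[ℂ] H)} {φ : H} {j : ℤ}
    {ξ : H} : ξ ∈ resolutionSpace U π φ j ↔ (U ^ j) ξ ∈ baseSpace π φ := by
  rw [resolutionSpace, Submodule.mem_map]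
  constructor
  · rintro ⟨η, hη, rfl⟩
    have : (U ^ j) ((U ^ (-j)) η) = η := by
      rw [← Function.comp_apply (f := ⇑(U ^ j)), ← LinearIsometryEquiv.coe_mul, ← zpow_add,
        add_neg_cancel, zpow_zero]
      rfl
    change (U ^ j) ((U ^ (-j)) η) ∈ _
    rwa [this]
  · intro hξ
    refine ⟨_, hξ, ?_⟩
    change (U ^ (-j)) ((U ^ j) ξ) = ξ
    rw [← Function.comp_apply (f := ⇑(U ^ (-j))), ← LinearIsometryEquiv.coe_mul, ← zpow_add,
      neg_add_cancel, zpow_zero]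
    rfl

omit [CompleteSpace H] in
theorem zpow_apply_zpow_apply (U : H ≃ₗᵢ[ℂ] H) (i j : ℤ) (ξ : H) :
    (U ^ i) ((U ^ j) ξ) = (U ^ (i + j)) ξ := by
  rw [zpow_add]; rfl

theorem mem_resolutionSpace_zpow_iff {U : H ≃ₗᵢ[ℂ] H} {π : Linf →⋆ₐ[ℂ] (H →L[ℂ] H)} {φ : H}
    {i j : ℤ} {ξ : H} :
    (U ^ i) ξ ∈ resolutionSpace U π φ j ↔ ξ ∈ resolutionSpace U π φ (j + i) := by
  rw [mem_resolutionSpace_iff, mem_resolutionSpace_iff, zpow_apply_zpow_apply]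

theorem mem_resolutionSpace_zero_iff {U : H ≃ₗᵢ[ℂ] H} {π : Linf →⋆ₐ[ℂ] (H →L[ℂ] H)} {φ : H}
    {ξ : H} : ξ ∈ resolutionSpace U π φ 0 ↔ ξ ∈ baseSpace π φ :=
  mem_resolutionSpace_iff

theorem isClosed_baseSpace (π : Linf →⋆ₐ[ℂ] (H →L[ℂ] H)) (φ : H) :
    IsClosed (baseSpace π φ : Set H) :=
  Submodule.isClosed_topologicalClosure _

theorem isClosed_resolutionSpace (U : H ≃ₗᵢ[ℂ] H) (π : Linf →⋆ₐ[ℂ] (H →L[ℂ] H)) (φ : H) (j : ℤ) :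
    IsClosed (resolutionSpace U π φ j : Set H) := by
  have : (resolutionSpace U π φ j : Set H) = (U ^ j) ⁻¹' (baseSpace π φ : Set H) :=
    Set.ext fun _ => mem_resolutionSpace_iff
  rw [this]
  exact (isClosed_baseSpace π φ).preimage (U ^ j).continuous

namespace IsCyclicRepresentation

variable {N : ℕ} [NeZero N] {m₀ : Linf} {h : Circle → ℝ} {U : H ≃ₗᵢ[ℂ] H}
  {π : Linf →⋆ₐ[ℂ] (H →L[ℂ] H)} {φ : H}

theorem conj_translation (hrep : IsCyclicRepresentation N m₀ h U π φ) :
    U * translation π * U⁻¹ = translation π ^ N := by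
  ext ξ
  have h1 : (translation π ^ N) ξ = π (charLinf N) ξ := by
    rw [← zpow_natCast, translation_zpow_apply]
  rw [h1, ← mul_one (N : ℤ), ← compPow_charLinf, charLinf_one, ← hrep.covariance]
  rfl

theorem apply_mem_baseSpace (hrep : IsCyclicRepresentation N m₀ h U π φ)
    (h_int : Integrable h μT) (h_nonneg : ∀ᵐ z ∂μT, 0 ≤ h z) {ξ : H} (hξ : ξ ∈ baseSpace π φ) :
    U ξ ∈ baseSpace π φ := by
  have hle : baseSpace π φ ≤ (baseSpace π φ).comap (U.toLinearEquiv : H →ₗ[ℂ] H) := by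
    refine Submodule.topologicalClosure_minimal _ (Submodule.span_le.mpr ?_)
      ((isClosed_baseSpace π φ).preimage U.continuous)
    rintro _ ⟨k, rfl⟩
    change U ((translation π ^ k) φ) ∈ baseSpace π φ
    rw [translation_zpow_apply, hrep.apply_map_apply]
    exact hrep.map_apply_mem_baseSpace h_int h_nonneg _
  exact hle hξ

theorem resolutionSpace_le_succ (hrep : IsCyclicRepresentation N m₀ h U π φ)
    (h_int : Integrable h μT) (h_nonneg : ∀ᵐ z ∂μT, 0 ≤ h z) (j : ℤ) :
    resolutionSpace U π φ j ≤ resolutionSpace U π φ (j + 1) := by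
  intro ξ hξ
  rw [mem_resolutionSpace_iff] at hξ ⊢
  have := hrep.apply_mem_baseSpace h_int h_nonneg hξ
  rwa [add_comm, zpow_add, zpow_one]

theorem monotone_resolutionSpace (hrep : IsCyclicRepresentation N m₀ h U π φ)
    (h_int : Integrable h μT) (h_nonneg : ∀ᵐ z ∂μT, 0 ≤ h z) :
    Monotone (resolutionSpace U π φ) :=
  monotone_int_of_le_succ (hrep.resolutionSpace_le_succ h_int h_nonneg)

theorem iSup_resolutionSpace_closure (hrep : IsCyclicRepresentation N m₀ h U π φ)
    (h_int : Integrable h μT) (h_nonneg : ∀ᵐ z ∂μT, 0 ≤ h z) :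
    (⨆ j, resolutionSpace U π φ j).topologicalClosure = ⊤ := by
  rw [eq_top_iff, ← hrep.cyclic]
  refine Submodule.topologicalClosure_mono (Submodule.span_le.mpr ?_)
  rintro _ ⟨n, f, rfl⟩
  refine Submodule.mem_iSup_of_mem (n : ℤ) ?_
  rw [mem_resolutionSpace_zpow_iff, add_neg_cancel, mem_resolutionSpace_zero_iff]
  exact hrep.map_apply_mem_baseSpace h_int h_nonneg f

theorem closure_iUnion_resolutionSpace (hrep : IsCyclicRepresentation N m₀ h U π φ)
    (h_int : Integrable h μT) (h_nonneg : ∀ᵐ z ∂μT, 0 ≤ h z) :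
    closure (⋃ j : ℤ, (resolutionSpace U π φ j : Set H)) = Set.univ := by
  rw [← Submodule.coe_iSup_of_directed _
    (hrep.monotone_resolutionSpace h_int h_nonneg).directed_le,
    ← Submodule.topologicalClosure_coe, hrep.iSup_resolutionSpace_closure h_int h_nonneg,
    Submodule.top_coe]

end IsCyclicRepresentation

/-! ### Harmonic functions -/

section Harmonic

variable {N : ℕ} [NeZero N] {m₀ : Linf} {h : Circle → ℝ}

theorem fiberAvg_of_transfer_eq {f : Circle → ℝ} (hf : transfer N m₀ f =ᵐ[μT] f) :
    ∀ᵐ z ∂μT, fiberAvg N (fun v => ‖m₀ v‖ ^ 2 * f v) z = f (z ^ N) := by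
  filter_upwards [ae_pow (N := N) hf] with z hz
  rw [← transfer_pow, hz]

/-- If h(z^N) = 0, a sum of nonnegative terms over the fibre vanishes, and m₀ ≠ 0 gives h(z) = 0.
The zero set thus contains its preimage under z ↦ z^N, and ergodicity decides. -/
theorem ae_eq_zero_or_ae_pos (hN : 2 ≤ N) (hm₀ : NonSingular m₀) (h_int : Integrable h μT)
    (h_nonneg : ∀ᵐ z ∂μT, 0 ≤ h z)
    (h_avg : ∀ᵐ z ∂μT, fiberAvg N (fun v => ‖m₀ v‖ ^ 2 * h v) z = h (z ^ N)) :
    (∀ᵐ z ∂μT, h z = 0) ∨ ∀ᵐ z ∂μT, 0 < h z := by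
  have hs : NullMeasurableSet (h ⁻¹' {0}) μT :=
    h_int.1.aemeasurable.nullMeasurable (measurableSet_singleton 0)
  have hsub : (fun z : Circle => z ^ N) ⁻¹' (h ⁻¹' {0}) ≤ᵐ[μT] (h ⁻¹' {0} : Set Circle) := by
    filter_upwards [h_avg, ae_fiber N h_nonneg, hm₀.1] with z h1 h2 h3 h4
    have h5 : h (z ^ N) = 0 := h4
    have hN0 : (N : ℝ)⁻¹ ≠ 0 := inv_ne_zero (Nat.cast_ne_zero.mpr (NeZero.ne N))
    rw [h5, fiberAvg, mul_eq_zero, or_iff_right hN0,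
      Finset.sum_eq_zero_iff_of_nonneg fun j _ => mul_nonneg (sq_nonneg _) (h2 j)] at h1
    have := h1 ⟨0, NeZero.pos N⟩ (Finset.mem_univ _)
    simp only [pow_zero, one_mul, mul_eq_zero, pow_eq_zero_iff two_ne_zero, norm_eq_zero] at this
    exact this.resolve_left h3
  rcases (ergodic_pow hN).ae_empty_or_univ_of_preimage_ae_le hs hsub with h1 | h1
  · right
    filter_upwards [eventuallyEq_set.mp h1, h_nonneg] with z h2 h3
    exact lt_of_le_of_ne h3 fun h4 => by simpa using h2.mp h4.symm
  · left
    filter_upwards [eventuallyEq_set.mp h1] with z h2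
    exact h2.mpr trivial

theorem weighted_absolutelyContinuous' (h_int : Integrable h μT) (h_pos : ∀ᵐ z ∂μT, 0 < h z) :
    μT ≪ weighted h :=
  withDensity_absolutelyContinuous' h_int.1.aemeasurable.ennreal_ofReal
    (h_pos.mono fun _ hz => (ENNReal.ofReal_pos.mpr hz).ne')

theorem ae_weighted (h_int : Integrable h μT) (h_pos : ∀ᵐ z ∂μT, 0 < h z) :
    ae (weighted h) = ae μT :=
  le_antisymm (weighted_absolutelyContinuous h).ae_le
    (weighted_absolutelyContinuous' h_int h_pos).ae_le

/-- Harmonicity is what makes S isometric: G(z^N) is constant on fibres, the fibre average of |m₀|²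
h is h(z^N), and z ↦ z^N preserves μ. -/
theorem lintegral_cascade (h_int : Integrable h μT) (h_nonneg : ∀ᵐ z ∂μT, 0 ≤ h z)
    (h_avg : ∀ᵐ z ∂μT, fiberAvg N (fun v => ‖m₀ v‖ ^ 2 * h v) z = h (z ^ N))
    {G : Circle → ℝ≥0∞} (hG : AEMeasurable G μT) :
    ∫⁻ z, ENNReal.ofReal (‖m₀ z‖ ^ 2) * G (z ^ N) ∂weighted h = ∫⁻ z, G z ∂weighted h := by
  have hσ := measurePreserving_pow N
  have hh : AEMeasurable (fun z => ENNReal.ofReal (h z)) μT :=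
    h_int.1.aemeasurable.ennreal_ofReal
  have hm : AEMeasurable (fun z => ENNReal.ofReal (‖m₀ z‖ ^ 2)) μT :=
    ((Lp.aestronglyMeasurable m₀).norm.aemeasurable.pow_const 2).ennreal_ofReal
  have hGσ : AEMeasurable (fun z => G (z ^ N)) μT :=
    hG.comp_quasiMeasurePreserving hσ.quasiMeasurePreserving
  have hmG : AEMeasurable (fun z => ENNReal.ofReal (‖m₀ z‖ ^ 2) * G (z ^ N)) μT := hm.mul hGσ
  have hhmG : AEMeasurable (fun z => ENNReal.ofReal (h z) *
      (ENNReal.ofReal (‖m₀ z‖ ^ 2) * G (z ^ N))) μT := hh.mul hmG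
  rw [weighted, lintegral_withDensity_eq_lintegral_mul₀ hh hmG,
    lintegral_withDensity_eq_lintegral_mul₀ hh hG]
  simp only [Pi.mul_apply]
  rw [lintegral_fiber (N := N) hhmG, ← lintegral_const_mul' _ _ (by simp [NeZero.ne N])]
  have hcomp : ∫⁻ z, ENNReal.ofReal (h (z ^ N)) * G (z ^ N) ∂μT
      = ∫⁻ z, ENNReal.ofReal (h z) * G z ∂μT := by
    conv_rhs => rw [← hσ.map_eq]
    rw [lintegral_map' (by rw [hσ.map_eq]; exact hh.mul hG) hσ.measurable.aemeasurable]
  rw [← hcomp]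
  refine lintegral_congr_ae ?_
  filter_upwards [h_avg, ae_fiber N h_nonneg] with z h1 h2
  simp only [rootOfUnity_pow_mul_pow]
  have h3 : ∀ j : Fin N, ENNReal.ofReal (h (rootOfUnity N ^ (j : ℕ) * z)) *
      (ENNReal.ofReal (‖m₀ (rootOfUnity N ^ (j : ℕ) * z)‖ ^ 2) * G (z ^ N)) =
      ENNReal.ofReal (‖m₀ (rootOfUnity N ^ (j : ℕ) * z)‖ ^ 2 *
        h (rootOfUnity N ^ (j : ℕ) * z)) * G (z ^ N) := fun j => by
    rw [ENNReal.ofReal_mul (sq_nonneg _)]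
    ring
  have hNpos : (0 : ℝ) < N := Nat.cast_pos.mpr (NeZero.pos N)
  rw [Finset.sum_congr rfl fun j _ => h3 j, ← Finset.sum_mul, ← mul_assoc,
    ← ENNReal.ofReal_sum_of_nonneg fun j _ => mul_nonneg (sq_nonneg _) (h2 j), ← h1, fiberAvg,
    ENNReal.ofReal_mul (by positivity), ENNReal.ofReal_inv_of_pos hNpos, ENNReal.ofReal_natCast]

theorem eLpNorm_cascade (h_int : Integrable h μT) (h_nonneg : ∀ᵐ z ∂μT, 0 ≤ h z)
    (h_avg : ∀ᵐ z ∂μT, fiberAvg N (fun v => ‖m₀ v‖ ^ 2 * h v) z = h (z ^ N))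
    {g : Circle → ℂ} (hg : AEStronglyMeasurable g μT) :
    eLpNorm (fun z => m₀ z * g (z ^ N)) 2 (weighted h) = eLpNorm g 2 (weighted h) := by
  rw [eLpNorm_eq_lintegral_rpow_enorm_toReal two_ne_zero ENNReal.ofNat_ne_top,
    eLpNorm_eq_lintegral_rpow_enorm_toReal two_ne_zero ENNReal.ofNat_ne_top]
  rw [← lintegral_cascade (G := fun z => ‖g z‖ₑ ^ (2 : ℝ≥0∞).toReal) h_int h_nonneg h_avg
    (hg.enorm.pow_const _)]
  congr 2
  funext z
  rw [enorm_mul, ENNReal.mul_rpow_of_nonneg _ _ (by simp)]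
  congr 1
  rw [ENNReal.toReal_ofNat, ENNReal.rpow_ofNat, ENNReal.ofReal_pow (norm_nonneg _),
    ofReal_norm]

theorem aestronglyMeasurable_of_Lp_weighted (h_int : Integrable h μT)
    (h_pos : ∀ᵐ z ∂μT, 0 < h z) (x : Lp ℂ 2 (weighted h)) : AEStronglyMeasurable x μT :=
  (Lp.aestronglyMeasurable x).mono_ac (weighted_absolutelyContinuous' h_int h_pos)

theorem eLpNorm_cascade_Lp (h_int : Integrable h μT) (h_pos : ∀ᵐ z ∂μT, 0 < h z)
    (h_avg : ∀ᵐ z ∂μT, fiberAvg N (fun v => ‖m₀ v‖ ^ 2 * h v) z = h (z ^ N))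
    (x : Lp ℂ 2 (weighted h)) :
    eLpNorm (fun z => m₀ z * x (z ^ N)) 2 (weighted h) = eLpNorm x 2 (weighted h) :=
  eLpNorm_cascade h_int (h_pos.mono fun _ hz => hz.le) h_avg
    (aestronglyMeasurable_of_Lp_weighted h_int h_pos x)

theorem memLp_cascade (h_int : Integrable h μT) (h_pos : ∀ᵐ z ∂μT, 0 < h z)
    (h_avg : ∀ᵐ z ∂μT, fiberAvg N (fun v => ‖m₀ v‖ ^ 2 * h v) z = h (z ^ N))
    (x : Lp ℂ 2 (weighted h)) : MemLp (fun z => m₀ z * x (z ^ N)) 2 (weighted h) :=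
  ⟨((Lp.aestronglyMeasurable m₀).mul
    ((aestronglyMeasurable_of_Lp_weighted h_int h_pos x).comp_quasiMeasurePreserving
      (measurePreserving_pow N).quasiMeasurePreserving)).mono_ac (weighted_absolutelyContinuous h),
    by rw [eLpNorm_cascade_Lp h_int h_pos h_avg]; exact (Lp.memLp x).2⟩

/-- The isometry `f ↦ m₀ · f(z^N)` of `L²(h μ)`. -/
def cascade (h_int : Integrable h μT) (h_pos : ∀ᵐ z ∂μT, 0 < h z)
    (h_avg : ∀ᵐ z ∂μT, fiberAvg N (fun v => ‖m₀ v‖ ^ 2 * h v) z = h (z ^ N)) :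
    Lp ℂ 2 (weighted h) →ₗᵢ[ℂ] Lp ℂ 2 (weighted h) :=
  -- Positivity of `h` makes h μ-null sets μ-null, so x(z^N) does not depend on the representative
  -- of x.
  have hac := weighted_absolutelyContinuous' h_int h_pos
  have hmem := memLp_cascade h_int h_pos h_avg
  { toFun := fun x => (hmem x).toLp _
    map_add' := fun x y => by
      rw [← MemLp.toLp_add]
      refine MemLp.toLp_congr _ ((hmem x).add (hmem y))
        ((weighted_absolutelyContinuous h).ae_eq ?_)
      filter_upwards [ae_pow (N := N) (hac.ae_eq (Lp.coeFn_add x y))] with z hz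
      rw [hz, Pi.add_apply, Pi.add_apply, mul_add]
    map_smul' := fun c x => by
      rw [RingHom.id_apply, ← MemLp.toLp_const_smul c (hmem x)]
      refine MemLp.toLp_congr _ ((hmem x).const_smul c)
        ((weighted_absolutelyContinuous h).ae_eq ?_)
      filter_upwards [ae_pow (N := N) (hac.ae_eq (Lp.coeFn_smul c x))] with z hz
      rw [hz, Pi.smul_apply, Pi.smul_apply, mul_smul_comm]
    norm_map' := fun x => by
      change ‖(hmem x).toLp _‖ = ‖x‖
      rw [Lp.norm_toLp, eLpNorm_cascade_Lp h_int h_pos h_avg, Lp.norm_def] }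

variable (h_int : Integrable h μT) (h_pos : ∀ᵐ z ∂μT, 0 < h z)
    (h_avg : ∀ᵐ z ∂μT, fiberAvg N (fun v => ‖m₀ v‖ ^ 2 * h v) z = h (z ^ N))

theorem coeFn_cascade (x : Lp ℂ 2 (weighted h)) :
    ∀ᵐ z ∂μT, cascade h_int h_pos h_avg x z = m₀ z * x (z ^ N) := by
  rw [← ae_weighted h_int h_pos]
  exact (memLp_cascade h_int h_pos h_avg x).coeFn_toLp

/-- The multiplier is the product of m₀(z^(N^k)) over k < n. That it does not depend on `x` lets it
cancel in quotients. -/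
theorem coeFn_cascade_iterate (hm₀ : ∀ᵐ z ∂μT, m₀ z ≠ 0) (n : ℕ) :
    ∃ M : Circle → ℂ, (∀ᵐ z ∂μT, M z ≠ 0) ∧ ∀ x : Lp ℂ 2 (weighted h),
      ∀ᵐ z ∂μT, (cascade h_int h_pos h_avg)^[n] x z = M z * x (z ^ N ^ n) := by
  induction n with
  | zero => exact ⟨fun _ => 1, by simp, fun x => by simp⟩
  | succ n ih =>
    obtain ⟨M, hM, hx⟩ := ih
    refine ⟨fun z => m₀ z * M (z ^ N), ?_, fun x => ?_⟩
    · filter_upwards [hm₀, ae_pow (N := N) hM] with z h1 h2 using mul_ne_zero h1 h2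
    · rw [Function.iterate_succ_apply']
      filter_upwards [coeFn_cascade h_int h_pos h_avg ((cascade h_int h_pos h_avg)^[n] x),
        ae_pow (N := N) (hx x)] with z h1 h2
      rw [h1, h2, ← pow_mul, ← pow_succ', mul_assoc]

/-- Two vectors in the intersection of the ranges of the iterates of `cascade` are proportional. -/
theorem exists_eq_const_mul (hN : 2 ≤ N) (hm₀ : ∀ᵐ z ∂μT, m₀ z ≠ 0)
    {x y : Lp ℂ 2 (weighted h)} (hx : ∀ n, ∃ x', (cascade h_int h_pos h_avg)^[n] x' = x)
    (hy : ∀ n, ∃ y', (cascade h_int h_pos h_avg)^[n] y' = y) (hy0 : y ≠ 0) :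
    (∀ᵐ z ∂μT, y z ≠ 0) ∧ ∃ c : ℂ, ∀ᵐ z ∂μT, x z = c * y z := by
  have hmeas : ∀ x : Lp ℂ 2 (weighted h), AEMeasurable x μT := fun x =>
    (aestronglyMeasurable_of_Lp_weighted h_int h_pos x).aemeasurable
  have key : ∀ x : Lp ℂ 2 (weighted h), (∀ n, ∃ x', (cascade h_int h_pos h_avg)^[n] x' = x) →
      ∀ (n : ℕ) (ζ : Circle), ζ ^ N ^ n = 1 →
        ∀ᵐ z ∂μT, x (ζ * z) / y (ζ * z) = x z / y z := by
    intro x hx n ζ hζ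
    obtain ⟨M, hM, hMx⟩ := coeFn_cascade_iterate h_int h_pos h_avg hm₀ n
    obtain ⟨x', rfl⟩ := hx n
    obtain ⟨y', hy'⟩ := hy n
    rw [← hy']
    filter_upwards [hM, hMx x', hMx y', ae_mul ζ hM, ae_mul ζ (hMx x'), ae_mul ζ (hMx y')]
      with z h1 h2 h3 h4 h5 h6
    rw [h2, h3, h5, h6, mul_pow, hζ, one_mul, mul_div_mul_left _ _ h1, mul_div_mul_left _ _ h4]
  have hyne : ∀ᵐ z ∂μT, y z ≠ 0 := by
    -- With 0/0 = 0, the quotient y/y is the indicator of {y ≠ 0}; being constant and not zero, it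
    -- shows that y vanishes almost nowhere.
    obtain ⟨c, hc⟩ := exists_ae_eq_const hN ((hmeas y).div (hmeas y)) (key y hy)
    have hc0 : c ≠ 0 := by
      rintro rfl
      refine hy0 (Lp.ext ?_)
      have : ∀ᵐ z ∂μT, y z = 0 := hc.mono fun z hz => by simpa using hz
      filter_upwards [(weighted_absolutelyContinuous h).ae_le this, Lp.coeFn_zero ℂ 2 (weighted h)]
        with z h1 h2
      rw [h1, h2, Pi.zero_apply]
    filter_upwards [hc] with z hz h0
    rw [Pi.div_apply, h0, div_zero] at hz
    exact hc0 hz.symm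
  obtain ⟨c, hc⟩ := exists_ae_eq_const hN ((hmeas x).div (hmeas y)) (key x hx)
  refine ⟨hyne, c, ?_⟩
  filter_upwards [hc, hyne] with z h1 h2
  rw [← h1, Pi.div_apply, div_mul_cancel₀ _ h2]

theorem norm_sq_mul_eq_of_mem_iInter_range (hN : 2 ≤ N) (hm₀ : ∀ᵐ z ∂μT, m₀ z ≠ 0)
    {x : Lp ℂ 2 (weighted h)} (hx : ∀ n, ∃ x', (cascade h_int h_pos h_avg)^[n] x' = x)
    (hx0 : x ≠ 0) : ∀ᵐ z ∂μT, ‖m₀ z‖ ^ 2 * h z = h (z ^ N) := by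
  set S := cascade h_int h_pos h_avg with hS
  -- S preserves the intersection of the ranges, which is at most one-dimensional, so x is an
  -- eigenvector.
  have hSx : ∀ n, ∃ x', S^[n] x' = S x := fun n => by
    obtain ⟨x', hx'⟩ := hx n
    exact ⟨S x', by rw [← Function.iterate_succ_apply, Function.iterate_succ_apply', hx']⟩
  obtain ⟨hne, c, hc⟩ := exists_eq_const_mul h_int h_pos h_avg hN hm₀ hSx hx hx0
  have hSc : S x = c • x := by
    apply Lp.ext
    filter_upwards [(weighted_absolutelyContinuous h).ae_le hc, Lp.coeFn_smul c x] with z h1 h2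
    rw [h1, h2, Pi.smul_apply, smul_eq_mul]
  have hc1 : ‖c‖ = 1 := by
    have h1 : ‖S x‖ = ‖x‖ := S.norm_map x
    rw [hSc, norm_smul] at h1
    exact mul_eq_right₀ (norm_ne_zero_iff.mpr hx0) |>.mp h1
  have hk : ∀ᵐ z ∂μT, ‖m₀ z‖ ^ 2 * ‖x (z ^ N)‖ ^ 2 = ‖x z‖ ^ 2 := by
    filter_upwards [hc, coeFn_cascade h_int h_pos h_avg x] with z h1 h2
    rw [← hS, h1] at h2
    rw [← mul_pow, ← norm_mul, ← h2, norm_mul, hc1, one_mul]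
  have hu : Integrable (fun z => ‖x z‖ ^ 2 * h z) μT := by
    have h1 : Integrable (fun z => ‖x z‖ ^ 2) (μT.withDensity fun z => ENNReal.ofReal (h z)) :=
      (memLp_two_iff_integrable_sq_norm (Lp.aestronglyMeasurable x)).mp (Lp.memLp x)
    rw [integrable_withDensity_iff_integrable_smul₀'
      h_int.1.aemeasurable.ennreal_ofReal
      (Eventually.of_forall fun _ => ENNReal.ofReal_lt_top)] at h1
    refine h1.congr ?_
    filter_upwards [h_pos] with z hz
    rw [ENNReal.toReal_ofReal hz.le, smul_eq_mul, mul_comm]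
  have hinv := comp_pow_eq_of_fiberAvg_eq (N := N) hu
    (h_pos.mono fun z hz => mul_nonneg (sq_nonneg _) hz.le) (by
      filter_upwards [h_avg, ae_fiber N hk] with z h1 h2
      rw [← h1, fiberAvg, fiberAvg, mul_left_comm]
      congr 1
      rw [Finset.mul_sum]
      refine Finset.sum_congr rfl fun j _ => ?_
      rw [← h2 j, rootOfUnity_pow_mul_pow]
      ring)
  -- Invariance of |x|² h, with |x|² rewritten as |m₀|² |x(z^N)|², gives the claim after cancelling
  -- |x(z^N)|².
  filter_upwards [hinv, hk, ae_pow (N := N) hne] with z h1 h2 h3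
  have h4 : ‖x (z ^ N)‖ ^ 2 ≠ 0 := pow_ne_zero 2 (norm_ne_zero_iff.mpr h3)
  refine mul_left_cancel₀ h4 ?_
  rw [← h1, ← h2]
  ring

/-- If `R 1 = 1`, the quasi-invariance `|m₀|² h = h(z^N)` forces `|m₀| = 1`. -/
theorem not_quasiInvariant (hm₀ : NonSingular m₀) (h_int : Integrable h μT)
    (h_one : transfer N m₀ (fun _ => 1) =ᵐ[μT] fun _ => 1) :
    ¬ ∀ᵐ z ∂μT, 0 < h z ∧ ‖m₀ z‖ ^ 2 * h z = h (z ^ N) := by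
  intro hq
  refine hm₀.2 ?_
  -- Here |m₀|² = h(z^N)/h, so R 1 = 1 says that 1/h has fibre average 1/h(z^N).
  have hinv := comp_pow_eq_of_fiberAvg_inv_eq (N := N) h_int (hq.mono fun _ hz => hz.1) (by
    filter_upwards [fiberAvg_of_transfer_eq h_one, ae_fiber N hq, ae_pow (N := N) hq]
      with z h1 h2 h3
    have h4 := h3.1.ne'
    refine mul_left_cancel₀ h4 ?_
    rw [mul_inv_cancel₀ h4, ← h1, fiberAvg, fiberAvg, mul_left_comm]
    congr 1
    rw [Finset.mul_sum]
    refine Finset.sum_congr rfl fun j _ => ?_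
    have h5 := (h2 j).1.ne'
    have h6 := (h2 j).2
    rw [rootOfUnity_pow_mul_pow] at h6
    rw [← h6]
    field_simp)
  filter_upwards [hq, hinv] with z h1 h2
  rw [← h2] at h1
  have h3 : ‖m₀ z‖ ^ 2 = 1 := mul_eq_right₀ h1.1.ne' |>.mp h1.2
  exact (pow_eq_one_iff_of_nonneg (norm_nonneg _) two_ne_zero).mp h3

end Harmonic

/-! ### Triviality of the intersection -/

namespace IsCyclicRepresentation

variable {N : ℕ} [NeZero N] {m₀ : Linf} {h : Circle → ℝ} {U : H ≃ₗᵢ[ℂ] H}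
  {π : Linf →⋆ₐ[ℂ] (H →L[ℂ] H)} {φ : H}

theorem eq_zero_of_ae_eq_zero (hrep : IsCyclicRepresentation N m₀ h U π φ)
    (h0 : ∀ᵐ z ∂μT, h z = 0) (ξ : H) : ξ = 0 := by
  have hφ : ∀ f : Linf, π f φ = 0 := fun f => by
    rw [← inner_self_eq_zero (𝕜 := ℂ), inner_map_apply, hrep.inner_eq]
    refine integral_eq_zero_of_ae ?_
    filter_upwards [h0] with z hz
    simp [hz]
  have htop := hrep.cyclic
  have hset : {ξ : H | ∃ (n : ℕ) (f : Linf), ξ = (U ^ (-(n : ℤ)) : H ≃ₗᵢ[ℂ] H) (π f φ)} ⊆ {0} := by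
    rintro _ ⟨n, f, rfl⟩
    rw [hφ, map_zero]
    rfl
  have : (⊤ : Submodule ℂ H) ≤ ⊥ := by
    rw [← htop]
    refine Submodule.topologicalClosure_minimal _ (Submodule.span_le.mpr ?_) isClosed_singleton
    simpa using hset
  exact (Submodule.mem_bot ℂ).mp (this trivial)

theorem eq_zero_of_forall_mem_resolutionSpace (hrep : IsCyclicRepresentation N m₀ h U π φ)
    (hN : 2 ≤ N) (hm₀ : NonSingular m₀)
    (h_int : Integrable h μT) (h_nonneg : ∀ᵐ z ∂μT, 0 ≤ h z) (h_harm : transfer N m₀ h =ᵐ[μT] h)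
    (hnot : ¬ ∀ᵐ z ∂μT, 0 < h z ∧ ‖m₀ z‖ ^ 2 * h z = h (z ^ N))
    {ξ : H} (hξ : ∀ j : ℤ, ξ ∈ resolutionSpace U π φ j) : ξ = 0 := by
  have h_avg := fiberAvg_of_transfer_eq h_harm
  rcases ae_eq_zero_or_ae_pos hN hm₀ h_int h_nonneg h_avg with h0 | h_pos
  · exact hrep.eq_zero_of_ae_eq_zero h0 ξ
  have := isFiniteMeasure_weighted h_int
  obtain ⟨J, hJ, hr⟩ := hrep.exists_isometry h_int h_nonneg
  set S := cascade h_int h_pos h_avg with hS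
  -- `J` intertwines S with `U`; by continuity it suffices to check this on bounded functions.
  have hUJ : ∀ x, U (J x) = J (S x) := fun x => by
    refine (denseRange_toWeighted h).induction_on x (isClosed_eq (U.continuous.comp J.continuous)
      (J.continuous.comp S.continuous)) fun f => ?_
    rw [hJ, hrep.apply_map_apply, ← hJ]
    congr 1
    apply Lp.ext
    rw [ae_weighted h_int h_pos]
    have hf := ae_weighted h_int h_pos ▸ coeFn_toWeighted h f
    have hf' := ae_weighted h_int h_pos ▸ coeFn_toWeighted h (f.compPow N * m₀)
    filter_upwards [hf', coeFn_cascade h_int h_pos h_avg (toWeighted h f), ae_pow (N := N) hf,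
      Linf.coeFn_mul (f.compPow N) m₀, coeFn_compPow N f] with z h1 h2 h3 h4 h5
    rw [h1, h2, h3, h4, h5, mul_comm]
  have hUJn : ∀ (n : ℕ) x, (U ^ (n : ℤ)) (J x) = J (S^[n] x) := fun n x => by
    induction n with
    | zero => rfl
    | succ n ih =>
      rw [Function.iterate_succ_apply', ← hUJ, ← ih, Nat.cast_succ, add_comm, zpow_add, zpow_one]
      rfl
  -- Membership in `V_{-n}` places the preimage of `ξ` under `J` in the range of S^n.
  have hmem : ∀ n : ℕ, ∃ x, J (S^[n] x) = ξ := fun n => by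
    have h1 := hξ (-(n : ℤ))
    rw [mem_resolutionSpace_iff, ← SetLike.mem_coe, ← hr] at h1
    obtain ⟨x, hx⟩ := h1
    refine ⟨x, ?_⟩
    rw [← hUJn, hx, zpow_apply_zpow_apply, add_neg_cancel, zpow_zero]
    rfl
  obtain ⟨x, hx⟩ := hmem 0
  rw [Function.iterate_zero, id_eq] at hx
  by_contra hξ0
  have hx0 : x ≠ 0 := by
    rintro rfl
    exact hξ0 (by rw [← hx, map_zero])
  have hxn : ∀ n, ∃ x', S^[n] x' = x := fun n => by
    obtain ⟨x', hx'⟩ := hmem n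
    exact ⟨x', J.injective (hx'.trans hx.symm)⟩
  refine hnot ?_
  filter_upwards [h_pos, norm_sq_mul_eq_of_mem_iInter_range h_int h_pos h_avg hN hm₀.1 hxn hx0]
    with z h1 h2 using ⟨h1, h2⟩

end IsCyclicRepresentation

/-! ### Orthonormal families -/

/-- After subtracting the projection onto the smaller closed span, the remainder is orthogonal to
every `v i` yet lies in their closed span, so it is zero. -/
theorem mem_closure_span_image_of_inner_eq_zero {ι : Type*} {v : ι → H} (hv : Orthonormal ℂ v)
    {s : Set ι} {x : H} (hx : x ∈ (Submodule.span ℂ (Set.range v)).topologicalClosure)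
    (h : ∀ i ∉ s, inner ℂ (v i) x = 0) :
    x ∈ (Submodule.span ℂ (v '' s)).topologicalClosure := by
  set K := (Submodule.span ℂ (v '' s)).topologicalClosure with hK
  have hKc : IsClosed (K : Set H) := Submodule.isClosed_topologicalClosure _
  have : CompleteSpace K := hKc.completeSpace_coe
  obtain ⟨p, hp, q, hq, rfl⟩ := K.exists_add_mem_mem_orthogonal x
  have hKle : K ≤ (Submodule.span ℂ (Set.range v)).topologicalClosure :=
    Submodule.topologicalClosure_mono (Submodule.span_mono (Set.image_subset_range _ _))
  have hqv : ∀ i, inner ℂ (v i) q = 0 := fun i => by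
    by_cases hi : i ∈ s
    · exact (Submodule.mem_orthogonal K q).mp hq _
        (Submodule.le_topologicalClosure _ (Submodule.subset_span ⟨i, hi, rfl⟩))
    · have h1 : K ≤ (Submodule.span ℂ {v i})ᗮ := by
        refine Submodule.topologicalClosure_minimal _ (Submodule.span_le.mpr ?_)
          (Submodule.isClosed_orthogonal _)
        rintro _ ⟨k, hk, rfl⟩
        refine Submodule.mem_orthogonal_singleton_iff_inner_right.mpr (hv.2 ?_)
        rintro rfl
        exact hi hk
      have h2 := Submodule.mem_orthogonal_singleton_iff_inner_right.mp (h1 hp)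
      have h3 := h i hi
      rwa [inner_add_right, h2, zero_add] at h3
  have hq2 : q ∈ (Submodule.span ℂ (Set.range v)).topologicalClosureᗮ := by
    rw [Submodule.orthogonal_closure, Submodule.mem_orthogonal]
    intro u hu
    induction hu using Submodule.span_induction with
    | mem u hu => obtain ⟨i, rfl⟩ := hu; exact hqv i
    | zero => exact inner_zero_left _
    | add a b _ _ ha hb => rw [inner_add_left, ha, hb, add_zero]
    | smul c a _ ha => rw [inner_smul_left, ha, mul_zero]
  have hq3 : q ∈ (Submodule.span ℂ (Set.range v)).topologicalClosure := by
    have := Submodule.sub_mem _ hx (hKle hp)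
    rwa [add_sub_cancel_left] at this
  have hq0 : q = 0 := inner_self_eq_zero.mp ((Submodule.mem_orthogonal _ _).mp hq2 q hq3)
  rwa [hq0, add_zero]

omit [CompleteSpace H] in
theorem inner_zpow_apply (U : H ≃ₗᵢ[ℂ] H) (i j : ℤ) (x y : H) :
    inner ℂ ((U ^ i) x) ((U ^ j) y) = inner ℂ x ((U ^ (j - i)) y) := by
  rw [← (U ^ i).inner_map_map x, zpow_apply_zpow_apply, add_sub_cancel]

/-! ### Filter banks -/

theorem integral_fiber {N : ℕ} [NeZero N] {f : Circle → ℂ} (hf : Integrable f μT) :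
    ∫ z, f z ∂μT = ∫ z, (N : ℂ)⁻¹ * ∑ j : Fin N, f (rootOfUnity N ^ (j : ℕ) * z) ∂μT := by
  rw [integral_const_mul, integral_finsetSum _ fun _ _ => Integrable.comp_mul hf _]
  simp_rw [integral_comp_mul]
  have : (N : ℂ) ≠ 0 := Nat.cast_ne_zero.mpr (NeZero.ne N)
  simp [this]

theorem Linf.integrable (f : Linf) : Integrable f μT :=
  (Lp.memLp f).integrable le_top

theorem filterMatrix_mul_conj {N : ℕ} (m : Fin N → Linf) (z : Circle) (i j k l : Fin N) :
    filterMatrix m z i k * (starRingEnd ℂ) (filterMatrix m z j l) =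
      (N : ℂ)⁻¹ * (m i (rootOfUnity N ^ (k : ℕ) * z) *
        (starRingEnd ℂ) (m j (rootOfUnity N ^ (l : ℕ) * z))) := by
  have h1 : ((Real.sqrt N : ℂ))⁻¹ * ((Real.sqrt N : ℂ))⁻¹ = (N : ℂ)⁻¹ := by
    rw [← mul_inv, ← Complex.ofReal_mul, Real.mul_self_sqrt (Nat.cast_nonneg N),
      Complex.ofReal_natCast]
  simp only [filterMatrix, Matrix.of_apply, map_mul, map_inv₀, Complex.conj_ofReal, rootOfUnity]
  rw [← h1]
  ring

theorem sum_filter_row {N : ℕ} {m : Fin N → Linf} {z : Circle}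
    (hz : filterMatrix m z ∈ Matrix.unitaryGroup (Fin N) ℂ) (i j : Fin N) :
    (N : ℂ)⁻¹ * ∑ r : Fin N, m i (rootOfUnity N ^ (r : ℕ) * z) *
      (starRingEnd ℂ) (m j (rootOfUnity N ^ (r : ℕ) * z)) = if i = j then 1 else 0 := by
  have h := congrFun (congrFun (Matrix.mem_unitaryGroup_iff.mp hz) i) j
  rw [Matrix.mul_apply, Matrix.one_apply] at h
  rw [← h, Finset.mul_sum]
  refine Finset.sum_congr rfl fun r _ => ?_
  rw [Matrix.star_apply, RCLike.star_def, filterMatrix_mul_conj]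

theorem sum_filter_column {N : ℕ} {m : Fin N → Linf} {z : Circle}
    (hz : filterMatrix m z ∈ Matrix.unitaryGroup (Fin N) ℂ) (r s : Fin N) :
    (N : ℂ)⁻¹ * ∑ i : Fin N, m i (rootOfUnity N ^ (r : ℕ) * z) *
      (starRingEnd ℂ) (m i (rootOfUnity N ^ (s : ℕ) * z)) = if s = r then 1 else 0 := by
  have h := congrFun (congrFun (Matrix.mem_unitaryGroup_iff'.mp hz) s) r
  rw [Matrix.mul_apply, Matrix.one_apply] at h
  rw [← h, Finset.mul_sum]
  refine Finset.sum_congr rfl fun i _ => ?_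
  rw [Matrix.star_apply, RCLike.star_def, mul_comm (starRingEnd ℂ _), filterMatrix_mul_conj]

/-- The average of `f ∈ L^∞` over the fibres of `z ↦ z ^ N`. -/
def avgLinf (N : ℕ) (f : Linf) : Linf :=
  (N : ℂ)⁻¹ • ∑ j : Fin N,
    Lp.compMeasurePreserving (fun z : Circle => rootOfUnity N ^ (j : ℕ) * z)
      (measurePreserving_mul _) f

theorem coeFn_avgLinf (N : ℕ) (f : Linf) :
    ∀ᵐ z ∂μT, avgLinf N f z = (N : ℂ)⁻¹ * ∑ j : Fin N, f (rootOfUnity N ^ (j : ℕ) * z) := by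
  have h1 : ∀ᵐ z ∂μT, ∀ j : Fin N,
      Lp.compMeasurePreserving (fun z : Circle => rootOfUnity N ^ (j : ℕ) * z)
        (measurePreserving_mul _) f z = f (rootOfUnity N ^ (j : ℕ) * z) :=
    ae_all_iff.mpr fun j => Lp.coeFn_compMeasurePreserving f (measurePreserving_mul _)
  filter_upwards [h1, Lp.coeFn_smul (N : ℂ)⁻¹ (∑ j : Fin N,
    Lp.compMeasurePreserving (fun z : Circle => rootOfUnity N ^ (j : ℕ) * z)
      (measurePreserving_mul _) f), Lp.coeFn_finsetSum Finset.univ fun j : Fin N =>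
    Lp.compMeasurePreserving (fun z : Circle => rootOfUnity N ^ (j : ℕ) * z)
      (measurePreserving_mul _) f] with z h2 h3 h4
  rw [avgLinf, h3, Pi.smul_apply, h4, smul_eq_mul, Finset.sum_apply]
  simp_rw [h2]

/-- The rotation by ρ^j multiplies the integral by ρ^(-jk), and these factors sum to zero. Fibre
averages thus have only frequencies divisible by N. -/
theorem integral_character_mul_avgLinf (N : ℕ) [NeZero N] (f : Linf) {k : ℤ} (hk : ¬ (N : ℤ) ∣ k) :
    ∫ z, ((z ^ k : Circle) : ℂ) * avgLinf N f z ∂μT = 0 := by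
  have hint : Integrable (fun z : Circle => ((z ^ k : Circle) : ℂ) * f z) μT := by
    refine (Linf.integrable (charLinf k * f)).congr ?_
    filter_upwards [Linf.coeFn_mul (charLinf k) f, coeFn_charLinf k] with z h1 h2
    rw [h1, h2]
  have hstep : ∀ j : Fin N,
      ∫ z, ((z ^ k : Circle) : ℂ) * f (rootOfUnity N ^ (j : ℕ) * z) ∂μT =
        (((rootOfUnity N : ℂ) ^ (-k)) ^ (j : ℕ)) * ∫ z, ((z ^ k : Circle) : ℂ) * f z ∂μT := by
    intro j
    rw [← integral_comp_mul (fun z => ((z ^ k : Circle) : ℂ) * f z) (rootOfUnity N ^ (j : ℕ)),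
      ← integral_const_mul]
    congr 1
    funext z
    rw [mul_zpow, Circle.coe_mul, ← mul_assoc, ← mul_assoc]
    congr 1
    have hne : (rootOfUnity N : ℂ) ≠ 0 := Circle.coe_ne_zero _
    rw [Circle.coe_zpow (rootOfUnity N ^ (j : ℕ)), Circle.coe_pow, ← zpow_natCast, ← zpow_natCast,
      ← zpow_mul, ← zpow_mul, ← zpow_add₀ hne, show -k * (j : ℤ) + (j : ℤ) * k = 0 by ring, zpow_zero,
      one_mul]
  have hint' : ∀ j : Fin N, Integrable
      (fun z : Circle => ((z ^ k : Circle) : ℂ) * f (rootOfUnity N ^ (j : ℕ) * z)) μT := by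
    intro j
    refine (Linf.integrable (charLinf k * Lp.compMeasurePreserving
      (fun z : Circle => rootOfUnity N ^ (j : ℕ) * z) (measurePreserving_mul _) f)).congr ?_
    filter_upwards [Linf.coeFn_mul (charLinf k) (Lp.compMeasurePreserving
      (fun z : Circle => rootOfUnity N ^ (j : ℕ) * z) (measurePreserving_mul _) f),
      coeFn_charLinf k, Lp.coeFn_compMeasurePreserving f
      (measurePreserving_mul (rootOfUnity N ^ (j : ℕ)))] with z h1 h2 h3
    rw [h1, h2, h3]
    rfl
  have hgeom : ∑ j : Fin N, ((rootOfUnity N : ℂ) ^ (-k)) ^ (j : ℕ) = 0 := by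
    have hp := isPrimitiveRoot_rootOfUnity N
    have h1 : (rootOfUnity N : ℂ) ^ (-k) ≠ 1 := fun h =>
      hk ((dvd_neg).mp ((hp.zpow_eq_one_iff_dvd _).mp h))
    have h2 : ((rootOfUnity N : ℂ) ^ (-k)) ^ N = 1 := by
      rw [← zpow_natCast, ← zpow_mul, mul_comm, zpow_mul, zpow_natCast, hp.pow_eq_one, one_zpow]
    rw [Fin.sum_univ_eq_sum_range (fun j => ((rootOfUnity N : ℂ) ^ (-k)) ^ j)]
    have := geom_sum_mul ((rootOfUnity N : ℂ) ^ (-k)) N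
    rw [h2, sub_self] at this
    exact (mul_eq_zero.mp this).resolve_right (sub_ne_zero.mpr h1)
  have hcongr : ∫ z, ((z ^ k : Circle) : ℂ) * avgLinf N f z ∂μT = ∫ z, (N : ℂ)⁻¹ *
      ∑ j : Fin N, ((z ^ k : Circle) : ℂ) * f (rootOfUnity N ^ (j : ℕ) * z) ∂μT := by
    refine integral_congr_ae ?_
    filter_upwards [coeFn_avgLinf N f] with z hz
    rw [hz, ← Finset.mul_sum]
    ring
  rw [hcongr, integral_const_mul, integral_finsetSum _ fun j _ => hint' j,
    Finset.sum_congr rfl fun j _ => hstep j, ← Finset.sum_mul, hgeom, zero_mul, mul_zero]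

/-- Reconstruction of a bounded function from its analysis by a unitary filter bank. -/
theorem sum_mul_avgLinf {N : ℕ} [NeZero N] {m : Fin N → Linf} (hm : IsUnitaryFilterBank m)
    (f : Linf) : ∑ i, m i * avgLinf N (f * star (m i)) = f := by
  apply Lp.ext
  have h1 : ∀ᵐ z ∂μT, ∀ i, (m i * avgLinf N (f * star (m i)) : Linf) z =
      m i z * ((N : ℂ)⁻¹ * ∑ j : Fin N, f (rootOfUnity N ^ (j : ℕ) * z) *
        (starRingEnd ℂ) (m i (rootOfUnity N ^ (j : ℕ) * z))) := by
    refine ae_all_iff.mpr fun i => ?_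
    filter_upwards [Linf.coeFn_mul (m i) (avgLinf N (f * star (m i))),
      coeFn_avgLinf N (f * star (m i)), ae_fiber N (Linf.coeFn_mul f (star (m i))),
      ae_fiber N (Lp.coeFn_star (m i))] with z h2 h3 h4 h5
    rw [h2, h3]
    congr 2
    refine Finset.sum_congr rfl fun j _ => ?_
    rw [h4, h5, Pi.star_apply, RCLike.star_def]
  filter_upwards [h1, hm, Lp.coeFn_finsetSum Finset.univ
    fun i => (m i * avgLinf N (f * star (m i)) : Linf)] with z h2 h3 h4
  rw [h4, Finset.sum_apply]
  simp_rw [h2]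
  have h5 : ∀ i, m i z * ((N : ℂ)⁻¹ * ∑ j : Fin N, f (rootOfUnity N ^ (j : ℕ) * z) *
      (starRingEnd ℂ) (m i (rootOfUnity N ^ (j : ℕ) * z))) =
      ∑ j : Fin N, f (rootOfUnity N ^ (j : ℕ) * z) * ((N : ℂ)⁻¹ * (m i z *
        (starRingEnd ℂ) (m i (rootOfUnity N ^ (j : ℕ) * z)))) := fun i => by
    rw [Finset.mul_sum, Finset.mul_sum]
    exact Finset.sum_congr rfl fun j _ => by ring
  simp_rw [h5]
  -- Summing over the filters first lets column orthogonality discard every rotation except j = 0.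
  rw [Finset.sum_comm]
  simp_rw [← Finset.mul_sum]
  have h6 := fun j => sum_filter_column h3 ⟨0, NeZero.pos N⟩ j
  simp only [pow_zero, one_mul] at h6
  simp_rw [h6]
  rw [Finset.sum_eq_single (⟨0, NeZero.pos N⟩ : Fin N)
    (fun j _ hj => by rw [if_neg hj, mul_zero]) (by simp)]
  simp

/-! ### Orthonormal bases when h = 1 -/

namespace IsCyclicRepresentation

variable {N : ℕ} [NeZero N] {m₀ : Linf} {h : Circle → ℝ} {U : H ≃ₗᵢ[ℂ] H}
  {π : Linf →⋆ₐ[ℂ] (H →L[ℂ] H)} {φ : H}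

theorem inner_map_apply_map_apply (hrep : IsCyclicRepresentation N m₀ h U π φ)
    (h1 : ∀ᵐ z ∂μT, h z = 1) (f g : Linf) :
    inner ℂ (π f φ) (π g φ) = ∫ z, (starRingEnd ℂ) (f z) * g z ∂μT := by
  rw [inner_map_apply, hrep.inner_eq]
  refine integral_congr_ae ?_
  filter_upwards [h1, Linf.coeFn_mul (star f) g, Lp.coeFn_star f] with z h2 h3 h4
  rw [h2, h3, h4, Complex.ofReal_one, mul_one, Pi.star_apply, RCLike.star_def]

theorem orthonormal_translates (hrep : IsCyclicRepresentation N m₀ h U π φ)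
    (h1 : ∀ᵐ z ∂μT, h z = 1) : Orthonormal ℂ fun k : ℤ => (translation π ^ k) φ := by
  rw [orthonormal_iff_ite]
  intro j k
  rw [translation_zpow_apply, translation_zpow_apply, inner_map_apply, star_charLinf,
    ← charLinf_add, hrep.inner_eq]
  have : ∫ z, charLinf (-j + k) z * (h z : ℂ) ∂μT =
      ∫ z : Circle, ((z ^ (-j + k) : Circle) : ℂ) ∂μT := by
    refine integral_congr_ae ?_
    filter_upwards [h1, coeFn_charLinf (-j + k)] with z h2 h3
    rw [h2, h3, Complex.ofReal_one, mul_one]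
  rw [this, integral_character]
  congr 1
  rw [eq_iff_iff]
  omega

/-- One application of `U` moves the wavelets into `V_0`, where they are the functions z^(Nk) m(z).
-/
theorem apply_translation_wavelet (hrep : IsCyclicRepresentation N m₀ h U π φ) (k : ℤ)
    (m : Linf) :
    U ((translation π ^ k) (wavelet U π φ m)) = π (charLinf (N * k) * m) φ := by
  rw [translation_zpow_apply, wavelet, hrep.covariance, compPow_charLinf, map_mul_apply]

theorem wavelet_self (hrep : IsCyclicRepresentation N m₀ h U π φ) : wavelet U π φ m₀ = φ := by
  rw [wavelet, ← hrep.scaling]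
  exact U.symm_apply_apply φ

/-- In `V_0` the factor z^(N(l-k)) is constant on fibres, so averaging reduces the inner product to
row orthogonality times a character integral. Index 0 is kept: for the filter `m₀` the wavelet is
`φ` itself. -/
theorem orthonormal_filterBank (hrep : IsCyclicRepresentation N m₀ h U π φ)
    (h1 : ∀ᵐ z ∂μT, h z = 1) {m : Fin N → Linf} (hm : IsUnitaryFilterBank m) :
    Orthonormal ℂ fun p : ℤ × Fin N => (translation π ^ p.1) (wavelet U π φ (m p.2)) := by
  rw [orthonormal_iff_ite]
  rintro ⟨k, i⟩ ⟨l, j⟩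
  rw [← U.inner_map_map, hrep.apply_translation_wavelet, hrep.apply_translation_wavelet,
    inner_map_apply, hrep.inner_eq]
  set F : Linf := star (charLinf (N * k) * m i) * (charLinf (N * l) * m j) with hF
  have hFz : ∀ᵐ z ∂μT, F z =
      (((z ^ N) ^ (l - k) : Circle) : ℂ) * (m j z * (starRingEnd ℂ) (m i z)) := by
    have e : F = charLinf (N * (l - k)) * (m j * star (m i)) := by
      rw [hF, star_mul, star_charLinf, show (N : ℤ) * (l - k) = -(N * k) + N * l by ring,
        charLinf_add]
      ring
    rw [e]
    filter_upwards [Linf.coeFn_mul (charLinf (N * (l - k))) (m j * star (m i)),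
      Linf.coeFn_mul (m j) (star (m i)), Lp.coeFn_star (m i), coeFn_charLinf (N * (l - k))]
      with z h2 h3 h4 h5
    rw [h2, h3, h4, h5, Pi.star_apply, RCLike.star_def, zpow_mul, zpow_natCast]
  have e1 : ∫ z, F z * (h z : ℂ) ∂μT = ∫ z, F z ∂μT := by
    refine integral_congr_ae ?_
    filter_upwards [h1] with z h2
    rw [h2, Complex.ofReal_one, mul_one]
  have e2 : ∫ z, F z ∂μT =
      ∫ z : Circle, ((z ^ (N * (l - k)) : Circle) : ℂ) * (if j = i then 1 else 0) ∂μT := by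
    rw [integral_fiber (N := N) (Linf.integrable F)]
    refine integral_congr_ae ?_
    filter_upwards [ae_fiber N hFz, hm] with z h2 h3
    simp_rw [h2, rootOfUnity_pow_mul_pow]
    rw [← Finset.mul_sum, mul_left_comm, sum_filter_row h3, zpow_mul, zpow_natCast]
  rw [e1, e2, integral_mul_const, integral_character]
  by_cases hkl : k = l
  · subst hkl
    by_cases hij : i = j
    · simp [hij]
    · simp [hij, Ne.symm hij]
  · simp [hkl, NeZero.ne N, sub_eq_zero, Ne.symm hkl]

theorem closure_span_filterBank (hrep : IsCyclicRepresentation N m₀ h U π φ)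
    (h_int : Integrable h μT) (h1 : ∀ᵐ z ∂μT, h z = 1)
    {m : Fin N → Linf} (hm : IsUnitaryFilterBank m) :
    (Submodule.span ℂ (Set.range fun p : ℤ × Fin N =>
      (translation π ^ p.1) (wavelet U π φ (m p.2)))).topologicalClosure =
        resolutionSpace U π φ 1 := by
  have h_nonneg : ∀ᵐ z ∂μT, 0 ≤ h z := h1.mono fun z hz => hz ▸ zero_le_one
  set E := (Submodule.span ℂ (Set.range fun p : ℤ × Fin N =>
      (translation π ^ p.1) (wavelet U π φ (m p.2)))).topologicalClosure with hE
  have hEc : IsClosed (E : Set H) := Submodule.isClosed_topologicalClosure _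
  refine le_antisymm ?_ ?_
  · refine Submodule.topologicalClosure_minimal _ (Submodule.span_le.mpr ?_)
      (isClosed_resolutionSpace U π φ 1)
    rintro _ ⟨⟨k, i⟩, rfl⟩
    rw [SetLike.mem_coe, mem_resolutionSpace_iff, zpow_one, hrep.apply_translation_wavelet]
    exact hrep.map_apply_mem_baseSpace h_int h_nonneg _
  have hchar : ∀ k : ℤ, U⁻¹ (π (charLinf k) φ) ∈ E := by
    intro k
    -- Reconstruction writes z^k as the sum of m_i c_i with c_i a fibre average. Hence π(c_i)φ is a
    -- limit of combinations of T^(Nl)φ, and U^{-1} π(m_i) sends T^(Nl)φ to a translate of the i-th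
    -- wavelet.
    rw [← sum_mul_avgLinf hm (charLinf k), map_sum, sum_apply, map_sum]
    refine Submodule.sum_mem _ fun i _ => ?_
    rw [map_mul_apply]
    set c := avgLinf N (charLinf k * star (m i)) with hc
    have hmem := mem_closure_span_image_of_inner_eq_zero (hrep.orthonormal_translates h1)
      (s := {l : ℤ | (N : ℤ) ∣ l}) (x := π c φ)
      (hrep.map_apply_mem_baseSpace h_int h_nonneg c) (by
        intro l hl
        rw [translation_zpow_apply, hrep.inner_map_apply_map_apply h1,
          ← integral_character_mul_avgLinf N (charLinf k * star (m i)) (k := -l)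
            fun hd => hl ((dvd_neg).mp hd)]
        refine integral_congr_ae ?_
        filter_upwards [coeFn_charLinf l] with z hz
        rw [hz, zpow_neg, Circle.coe_inv_eq_conj])
    have hle : (Submodule.span ℂ ((fun k : ℤ => (translation π ^ k) φ) ''
        {l : ℤ | (N : ℤ) ∣ l})).topologicalClosure ≤
        E.comap ((U⁻¹.toContinuousLinearEquiv : H →L[ℂ] H) ∘L π (m i) : H →L[ℂ] H).toLinearMap := by
      refine Submodule.topologicalClosure_minimal _ (Submodule.span_le.mpr ?_)
        (hEc.preimage ((U⁻¹.toContinuousLinearEquiv : H →L[ℂ] H) ∘L π (m i)).continuous)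
      rintro _ ⟨_, ⟨l, rfl⟩, rfl⟩
      change U⁻¹ (π (m i) ((translation π ^ ((N : ℤ) * l)) φ)) ∈ E
      refine Submodule.le_topologicalClosure _ (Submodule.subset_span ⟨(l, i), ?_⟩)
      rw [translation_zpow_apply, ← map_mul_apply, mul_comm (m i),
        ← hrep.apply_translation_wavelet]
      exact (U.symm_apply_apply _).symm
    exact hle hmem
  intro ξ hξ
  rw [mem_resolutionSpace_iff, zpow_one] at hξ
  have hle : baseSpace π φ ≤ E.comap (U⁻¹.toLinearEquiv : H →ₗ[ℂ] H) := by
    refine Submodule.topologicalClosure_minimal _ (Submodule.span_le.mpr ?_)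
      (hEc.preimage U⁻¹.continuous)
    rintro _ ⟨k, rfl⟩
    change U⁻¹ ((translation π ^ k) φ) ∈ E
    rw [translation_zpow_apply]
    exact hchar k
  have : U⁻¹ (U ξ) ∈ E := hle hξ
  rwa [show U⁻¹ (U ξ) = ξ from U.symm_apply_apply ξ] at this

theorem isOrthonormalBasisOf_translates (hrep : IsCyclicRepresentation N m₀ h U π φ)
    (h1 : ∀ᵐ z ∂μT, h z = 1) :
    IsOrthonormalBasisOf (fun k : ℤ => (translation π ^ k) φ) (resolutionSpace U π φ 0) :=
  ⟨hrep.orthonormal_translates h1, Submodule.ext fun _ => mem_resolutionSpace_zero_iff.symm⟩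

theorem isOrthonormalBasisOf_wavelets (hrep : IsCyclicRepresentation N m₀ h U π φ)
    (h_int : Integrable h μT) (h1 : ∀ᵐ z ∂μT, h z = 1)
    {m : Fin N → Linf} (hm0 : m 0 = m₀) (hm : IsUnitaryFilterBank m) :
    IsOrthonormalBasisOf
      (fun p : ℤ × {i : Fin N // i ≠ 0} => (translation π ^ p.1) (wavelet U π φ (m p.2)))
      (resolutionSpace U π φ 1 ⊓ (resolutionSpace U π φ 0)ᗮ) := by
  have ho := hrep.orthonormal_filterBank h1 hm
  have hinj : Function.Injective
      fun p : ℤ × {i : Fin N // i ≠ 0} => ((p.1, p.2.1) : ℤ × Fin N) := by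
    rintro ⟨k, i⟩ ⟨l, j⟩ hkl
    simp only [Prod.mk.injEq] at hkl
    exact Prod.ext hkl.1 (Subtype.ext hkl.2)
  have hzero : ∀ k : ℤ, (translation π ^ k) (wavelet U π φ (m 0)) = (translation π ^ k) φ := by
    intro k
    rw [hm0, hrep.wavelet_self]
  refine ⟨ho.comp _ hinj, le_antisymm ?_ ?_⟩
  · refine Submodule.topologicalClosure_minimal _ (Submodule.span_le.mpr ?_)
      ((isClosed_resolutionSpace U π φ 1).inter (Submodule.isClosed_orthogonal _))
    rintro _ ⟨⟨k, i, hi⟩, rfl⟩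
    refine ⟨?_, ?_⟩
    · rw [← hrep.closure_span_filterBank h_int h1 hm]
      exact Submodule.le_topologicalClosure _ (Submodule.subset_span ⟨(k, i), rfl⟩)
    · rw [← (hrep.isOrthonormalBasisOf_translates h1).2, Submodule.orthogonal_closure,
        SetLike.mem_coe, Submodule.mem_orthogonal]
      intro u hu
      induction hu using Submodule.span_induction with
      | mem u hu =>
        obtain ⟨l, rfl⟩ := hu
        have := ho.2 (i := (l, 0)) (j := (k, i)) (by simpa using fun _ => Ne.symm hi)
        simpa only [hzero] using this
      | zero => exact inner_zero_left _
      | add a b _ _ ha hb => rw [inner_add_left, ha, hb, add_zero]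
      | smul c a _ ha => rw [inner_smul_left, ha, mul_zero]
  · rintro ξ ⟨hξ1, hξ0⟩
    rw [SetLike.mem_coe, ← hrep.closure_span_filterBank h_int h1 hm] at hξ1
    -- The members with index 0 are the translates of `φ`, so orthogonality to `V_0` removes exactly
    -- these from the expansion in `V_1`.
    have := mem_closure_span_image_of_inner_eq_zero ho (s := {p | p.2 ≠ 0}) hξ1 (by
      rintro ⟨k, i⟩ hi
      have hi0 : i = 0 := by simpa using hi
      subst hi0
      rw [hzero]
      refine (Submodule.mem_orthogonal _ _).mp hξ0 _ ?_
      rw [← (hrep.isOrthonormalBasisOf_translates h1).2]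
      exact Submodule.le_topologicalClosure _ (Submodule.subset_span ⟨k, rfl⟩))
    refine Submodule.topologicalClosure_mono (Submodule.span_mono ?_) this
    rintro _ ⟨⟨k, i⟩, hi, rfl⟩
    exact ⟨(k, ⟨i, hi⟩), rfl⟩

theorem isOrthonormalBasisOf_dilates (hrep : IsCyclicRepresentation N m₀ h U π φ)
    (h_int : Integrable h μT) (h1 : ∀ᵐ z ∂μT, h z = 1)
    (hinter : ∀ ξ, (∀ j : ℤ, ξ ∈ resolutionSpace U π φ j) → ξ = 0) {ι : Type*} {w : ι → H}
    (hw : IsOrthonormalBasisOf w (resolutionSpace U π φ 1 ⊓ (resolutionSpace U π φ 0)ᗮ)) :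
    IsOrthonormalBasisOf (fun p : ℤ × ι => (U ^ p.1) (w p.2)) ⊤ := by
  have h_nonneg : ∀ᵐ z ∂μT, 0 ≤ h z := h1.mono fun z hz => hz ▸ zero_le_one
  have hmono := hrep.monotone_resolutionSpace h_int h_nonneg
  set V := resolutionSpace U π φ with hV
  have hwmem : ∀ i, w i ∈ V 1 ⊓ (V 0)ᗮ := fun i => by
    rw [← hw.2]
    exact Submodule.le_topologicalClosure _ (Submodule.subset_span ⟨i, rfl⟩)
  have hlt : ∀ (a b : ℤ) (i j : ι), a < b → inner ℂ ((U ^ b) (w j)) ((U ^ a) (w i)) = 0 := by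
    intro a b i j hab
    rw [← inner_conj_symm, inner_zpow_apply]
    have h2 : (U ^ (b - a)) (w j) ∈ V 0 := by
      rw [mem_resolutionSpace_zpow_iff]
      exact hmono (by omega) (hwmem j).1
    rw [← inner_conj_symm, (Submodule.mem_orthogonal _ _).mp (hwmem i).2 _ h2, map_zero, map_zero]
  refine ⟨⟨?_, ?_⟩, ?_⟩
  · rintro ⟨a, i⟩
    rw [LinearIsometryEquiv.norm_map]
    exact hw.1.1 i
  · rintro ⟨a, i⟩ ⟨b, j⟩ hne
    rcases lt_trichotomy a b with hab | rfl | hab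
    · have := hlt a b i j hab
      change inner ℂ ((U ^ a) (w i)) ((U ^ b) (w j)) = 0
      rw [← inner_conj_symm, this, map_zero]
    · change inner ℂ ((U ^ a) (w i)) ((U ^ a) (w j)) = 0
      rw [LinearIsometryEquiv.inner_map_map]
      exact hw.1.2 fun hij => hne (by rw [hij])
    · exact hlt b a j i hab
  rw [Submodule.topologicalClosure_eq_top_iff, Submodule.eq_bot_iff]
  intro v hv
  -- A vector orthogonal to all dilates is orthogonal to every detail space V_{a+1} ⊖ V_a, since U^a
  -- carries that space into V_1 ⊖ V_0.
  have hv' : ∀ (a : ℤ) (b : H), b ∈ V (a + 1) → b ∈ (V a)ᗮ → inner ℂ b v = 0 := by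
    intro a b hb1 hb0
    have hb : (U ^ a) b ∈ V 1 ⊓ (V 0)ᗮ := by
      refine ⟨by rw [hV, SetLike.mem_coe, mem_resolutionSpace_zpow_iff, add_comm]; exact hb1, ?_⟩
      rw [SetLike.mem_coe, Submodule.mem_orthogonal]
      intro u hu
      have hu' : (U ^ (-a)) u ∈ V a := by
        rw [hV, mem_resolutionSpace_zpow_iff, add_neg_cancel]; exact hu
      have := (Submodule.mem_orthogonal _ _).mp hb0 _ hu'
      rwa [← (U ^ a).inner_map_map, zpow_apply_zpow_apply, add_neg_cancel, zpow_zero] at this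
    rw [← hw.2] at hb
    have hle : (Submodule.span ℂ (Set.range w)).topologicalClosure ≤
        (Submodule.span ℂ {(U ^ a) v})ᗮ := by
      refine Submodule.topologicalClosure_minimal _ (Submodule.span_le.mpr ?_)
        (Submodule.isClosed_orthogonal _)
      rintro _ ⟨i, rfl⟩
      refine Submodule.mem_orthogonal_singleton_iff_inner_left.mpr ?_
      have := (Submodule.mem_orthogonal _ _).mp hv _
        (Submodule.subset_span ⟨((-a, i) : ℤ × ι), rfl⟩)
      change inner ℂ ((U ^ (-a)) (w i)) v = 0 at this
      rwa [← (U ^ a).inner_map_map, zpow_apply_zpow_apply, add_neg_cancel, zpow_zero] at this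
    have := Submodule.mem_orthogonal_singleton_iff_inner_left.mp (hle hb)
    rwa [LinearIsometryEquiv.inner_map_map] at this
  have hcomplete : ∀ a, CompleteSpace (V a) := fun a =>
    (isClosed_resolutionSpace U π φ a).completeSpace_coe
  have hsplit : ∀ (a : ℤ) (x : H), x ∈ V (a + 1) →
      ∃ y ∈ V a, ∃ b, b ∈ V (a + 1) ∧ b ∈ (V a)ᗮ ∧ x = y + b := by
    intro a x hx
    obtain ⟨y, hy, b, hb, rfl⟩ := (V a).exists_add_mem_mem_orthogonal x
    refine ⟨y, hy, b, ?_, hb, rfl⟩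
    have := Submodule.sub_mem _ hx (hmono (by omega : a ≤ a + 1) hy)
    rwa [add_sub_cancel_left] at this
  obtain ⟨p, hp, q, hq, hpq⟩ := (V 0).exists_add_mem_mem_orthogonal v
  -- As `v` has no component in any detail space, its splitting along `V 0` is its splitting along
  -- every `V j`; then `p` lies in the intersection and `q` is orthogonal to the dense union.
  have hall : ∀ j : ℤ, p ∈ V j ∧ q ∈ (V j)ᗮ := by
    have hup : ∀ j : ℤ, (p ∈ V j ∧ q ∈ (V j)ᗮ) → (p ∈ V (j + 1) ∧ q ∈ (V (j + 1))ᗮ) := by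
      rintro j ⟨hpj, hqj⟩
      refine ⟨hmono (by omega) hpj, (Submodule.mem_orthogonal _ _).mpr fun x hx => ?_⟩
      obtain ⟨y, hy, b, hb1, hb0, rfl⟩ := hsplit j x hx
      have h2 := hv' j b hb1 hb0
      rw [hpq, inner_add_right, ← inner_conj_symm,
        (Submodule.mem_orthogonal _ _).mp hb0 p hpj, map_zero, zero_add] at h2
      rw [inner_add_left, (Submodule.mem_orthogonal _ _).mp hqj y hy, h2, add_zero]
    have hdown : ∀ j : ℤ, (p ∈ V (j + 1) ∧ q ∈ (V (j + 1))ᗮ) → (p ∈ V j ∧ q ∈ (V j)ᗮ) := by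
      rintro j ⟨hpj, hqj⟩
      refine ⟨?_, Submodule.orthogonal_le (hmono (by omega : j ≤ j + 1)) hqj⟩
      obtain ⟨y, hy, b, hb1, hb0, hpb⟩ := hsplit j p hpj
      have h2 := hv' j b hb1 hb0
      rw [hpq, inner_add_right, (Submodule.mem_orthogonal _ _).mp hqj b hb1, add_zero, hpb,
        inner_add_right, ← inner_conj_symm, (Submodule.mem_orthogonal _ _).mp hb0 y hy, map_zero,
        zero_add] at h2
      rw [hpb, inner_self_eq_zero.mp h2, add_zero]
      exact hy
    intro j
    induction j with
    | zero => exact ⟨hp, hq⟩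
    | succ j ih => exact hup _ ih
    | pred j ih => exact hdown _ (by rwa [sub_add_cancel])
  have hp0 : p = 0 := hinter p fun j => (hall j).1
  have hq0 : q = 0 := by
    have h2 : q ∈ (⨆ j, V j).topologicalClosureᗮ := by
      rw [Submodule.orthogonal_closure, ← Submodule.iInf_orthogonal, Submodule.mem_iInf]
      exact fun j => (hall j).2
    rw [hV, hrep.iSup_resolutionSpace_closure h_int h_nonneg, Submodule.top_orthogonal_eq_bot] at h2
    exact h2
  rw [hpq, hp0, hq0, add_zero]

end IsCyclicRepresentation

end CyclicWavelet

end

open CyclicWavelet in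
theorem proposition5p1 {H : Type*} [NormedAddCommGroup H] [InnerProductSpace ℂ H]
    [CompleteSpace H] (N : ℕ) [NeZero N] (hN : 2 ≤ N)
    (m₀ : Linf) (hm₀ : NonSingular m₀)
    (h : Circle → ℝ) (h_int : Integrable h μT) (h_nonneg : ∀ᵐ z ∂μT, 0 ≤ h z)
    (h_harm : transfer N m₀ h =ᵐ[μT] h)
    (U : H ≃ₗᵢ[ℂ] H) (π : Linf →⋆ₐ[ℂ] (H →L[ℂ] H)) (φ : H)
    (hrep : IsCyclicRepresentation N m₀ h U π φ) :
    U * translation π * U⁻¹ = translation π ^ N ∧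
    (∀ j : ℤ, resolutionSpace U π φ j ≤ resolutionSpace U π φ (j + 1)) ∧
    closure (⋃ j : ℤ, (resolutionSpace U π φ j : Set H)) = Set.univ ∧
    ((transfer N m₀ (fun _ => 1) =ᵐ[μT] fun _ => 1) ∨
        ¬ (∀ᵐ z ∂μT, 0 < h z ∧ ‖m₀ z‖ ^ 2 * h z = h (z ^ N)) →
      ⋂ j : ℤ, (resolutionSpace U π φ j : Set H) = {0}) ∧
    ((∀ᵐ z ∂μT, h z = 1) →
      IsOrthonormalBasisOf (fun k : ℤ => (translation π ^ k) φ) (resolutionSpace U π φ 0) ∧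
      ∀ m : Fin N → Linf, m 0 = m₀ → IsUnitaryFilterBank m →
        IsOrthonormalBasisOf
          (fun p : ℤ × {i : Fin N // i ≠ 0} =>
            (translation π ^ p.1) (wavelet U π φ (m p.2)))
          (resolutionSpace U π φ 1 ⊓ (resolutionSpace U π φ 0)ᗮ) ∧
        IsOrthonormalBasisOf
          (fun p : ℤ × ℤ × {i : Fin N // i ≠ 0} =>
            (U ^ p.1) ((translation π ^ p.2.1) (wavelet U π φ (m p.2.2))))
          ⊤) := by
  refine ⟨hrep.conj_translation, hrep.resolutionSpace_le_succ h_int h_nonneg,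
    hrep.closure_iUnion_resolutionSpace h_int h_nonneg, fun hcase => ?_, fun h_one => ?_⟩
  · have hnot : ¬ ∀ᵐ z ∂μT, 0 < h z ∧ ‖m₀ z‖ ^ 2 * h z = h (z ^ N) :=
      hcase.elim (not_quasiInvariant hm₀ h_int) id
    refine Set.eq_singleton_iff_unique_mem.mpr
      ⟨Set.mem_iInter.mpr fun j => Submodule.zero_mem _, fun ξ hξ => ?_⟩
    exact hrep.eq_zero_of_forall_mem_resolutionSpace hN hm₀ h_int h_nonneg h_harm hnot
      fun j => Set.mem_iInter.mp hξ j
  -- For h = 1 quasi-invariance reads |m₀|² = 1, which non-singularity excludes directly.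
  · have hnot : ¬ ∀ᵐ z ∂μT, 0 < h z ∧ ‖m₀ z‖ ^ 2 * h z = h (z ^ N) := by
      intro hq
      refine hm₀.2 ?_
      filter_upwards [hq, h_one, ae_pow (N := N) h_one] with z h1 h2 h3
      have h4 := h1.2
      rw [h2, h3, mul_one] at h4
      exact (pow_eq_one_iff_of_nonneg (norm_nonneg _) two_ne_zero).mp h4
    refine ⟨hrep.isOrthonormalBasisOf_translates h_one, fun m hm0 hm => ?_⟩
    have hw := hrep.isOrthonormalBasisOf_wavelets h_int h_one hm0 hm
    refine ⟨hw, ?_⟩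
    exact hrep.isOrthonormalBasisOf_dilates h_int h_one
      (fun ξ hξ => hrep.eq_zero_of_forall_mem_resolutionSpace hN hm₀ h_int h_nonneg h_harm hnot hξ)
      hw
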